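/- **Setting.** Let $(M,\mathbf I,\mathbf J,\mathbf K,g)$ be a hyper-Kähler manifold with $\dim_{\mathbb C}M=r$: $\mathbf I,\mathbf J,\mathbf K$ are (integrable) complex structures with $\mathbf{IJ}=\mathbf K$, $\mathbf{JK}=\mathbf I$, $\mathbf{KI}=\mathbf J$, $g$ is a Riemannian metric compatible with all three, and the forms $\omega_{\mathbf I}=g(\mathbf I\cdot,\cdot)$, $\omega_{\mathbf J}=g(\mathbf J\cdot,\cdot)$, $\omega_{\mathbf K}=g(\mathbf K\cdot,\cdot)$ are closed. Let $Q$ be a complex manifold with $\dim_{\mathbb C}Q=n$, complex structure $I_Q$ and Kähler form $\omega_Q$, and let $h:Q\to\mathbb P^1$ be holomorphic. Neither $M$ nor $Q$ is assumed to be compact. Put $$(a,b,c)([Z_1,Z_2])=\frac{\bigl(|Z_2|^2-|Z_1|^2,\; Z_1\overline{Z}_2+\overline{Z}_1Z_2,\; \sqrt{-1}\,(\overline{Z}_1Z_2-Z_1\overline{Z}_2)\bigr)}{|Z_1|^2+|Z_2|^2}\in S^2 .$$ On the product manifold $X=M\times Q$ define, at $(m,q)$, with $(a,b,c)$ evaluated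 at $h(q)$, $$\mathbf I_M=a\,\mathbf I+b\,\mathbf J+c\,\mathbf K,\qquad \underline{\mathbf I}=(\mathbf I_M,I_Q)\ \text{ on } T_mM\oplus T_qQ,\qquad \omega_M=g(\mathbf I_M\cdot,\cdot)=a\,\omega_{\mathbf I}+b\,\omega_{\mathbf J}+c\,\omega_{\mathbf K},$$ where forms on $M$ and $Q$ are pulled back to $X$. **Theorem.** $\underline{\mathbf I}$ is a complex structure on $X$ (a smooth almost complex structure with vanishing Nijenhuis tensor), and for every real $t>0$ the form $\omega_M+t\omega_Q$ is a balanced metric on $(X,\underline{\mathbf I})$, that is, a smooth positive definite real $(1,1)$-form with $$d\bigl((\omega_M+t\omega_Q)^{\,n+r-1}\bigr)=0$$ (for $n=r=0$ the condition on the power is void). If moreover $M\neq\emptyset$, $r>0$ and $h$ is not locally constant, then this metric is not Kähler, that is, $d(\omega_M+t\omega_Q)\neq 0$. -/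

import Mathlib

open scoped Manifold ContDiff Topology LinearAlgebra.Projectivization
open Bundle VectorField Module

noncomputable section

/-! ### The complex projective line as a complex manifold -/

/-- The complex projective line, with homogeneous coordinates `[Z₁, Z₂]`; the coordinate `Z₁` has
index `0` and `Z₂` has index `1`. -/
abbrev CP1 : Type := ℙ ℂ (Fin 2 → ℂ)

namespace CP1

/-- The quotient topology from `ℂ² ∖ {0}`. -/
instance : TopologicalSpace CP1 :=
  inferInstanceAs (TopologicalSpace (Quotient (projectivizationSetoid ℂ (Fin 2 → ℂ))))

/-- The point with homogeneous coordinates `v`. -/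
def proj (v : {v : Fin 2 → ℂ // v ≠ 0}) : CP1 := Projectivization.mk ℂ v.1 v.2

theorem isQuotientMap_proj : Topology.IsQuotientMap proj :=
  isQuotientMap_quotient_mk' (s := projectivizationSetoid ℂ (Fin 2 → ℂ))

/-- The quotient of homogeneous coordinates `Z_{i+1} / Z_i`, indices modulo two. -/
def coord (i : Fin 2) (p : CP1) : ℂ :=
  Projectivization.lift (fun v : {v : Fin 2 → ℂ // v ≠ 0} => v.1 (i + 1) / v.1 i)
    (by
      intro a b t h
      have ht : t ≠ 0 := by
        rintro rfl
        exact a.2 (by simpa using h)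
      simp only [h, Pi.smul_apply, smul_eq_mul]
      exact mul_div_mul_left _ _ ht) p

/-- The set of points with `Z_i ≠ 0`. -/
def affineSet (i : Fin 2) : Set CP1 :=
  {p | Projectivization.lift (fun v : {v : Fin 2 → ℂ // v ≠ 0} => v.1 i ≠ 0)
    (by
      intro a b t h
      have ht : t ≠ 0 := by
        rintro rfl
        exact a.2 (by simpa using h)
      simp [h, ht]) p}

theorem update_ne_zero (i : Fin 2) (ζ : ℂ) :
    Function.update (fun _ : Fin 2 => ζ) i 1 ≠ 0 := by
  intro h
  have := congrFun h i
  simp at this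

/-- The point with `Z_i = 1` and `Z_{i+1} = ζ`. -/
def affinePoint (i : Fin 2) (ζ : ℂ) : CP1 :=
  Projectivization.mk ℂ (Function.update (fun _ => ζ) i 1) (update_ne_zero i ζ)

theorem isOpen_affineSet (i : Fin 2) : IsOpen (affineSet i) := by
  rw [← isQuotientMap_proj.isOpen_preimage]
  have : proj ⁻¹' affineSet i = {v | v.1 i ≠ 0} := rfl
  rw [this]
  exact isOpen_ne_fun ((continuous_apply i).comp continuous_subtype_val) continuous_const

theorem succ_ne (i : Fin 2) : i + 1 ≠ i := by
  fin_cases i <;> decide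

theorem coord_affinePoint (i : Fin 2) (ζ : ℂ) : coord i (affinePoint i ζ) = ζ := by
  simp [coord, affinePoint]

theorem affinePoint_mem (i : Fin 2) (ζ : ℂ) : affinePoint i ζ ∈ affineSet i := by
  simp [affineSet, affinePoint]

theorem affinePoint_coord (i : Fin 2) {p : CP1} (hp : p ∈ affineSet i) :
    affinePoint i (coord i p) = p := by
  induction p using Projectivization.ind with
  | h v hv =>
    have hvi : v i ≠ 0 := hp
    refine (Projectivization.mk_eq_mk_iff' ℂ _ _ _ _).2 ⟨(v i)⁻¹, ?_⟩
    ext j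
    by_cases hj : j = i
    · subst hj
      simp [hvi]
    · have : j = i + 1 := by
        fin_cases i <;> fin_cases j <;> simp_all
      subst this
      rw [Function.update_of_ne hj]
      simp only [Pi.smul_apply, smul_eq_mul]
      exact inv_mul_eq_div _ _

/-- The affine chart on `Z_i ≠ 0`. For `i = 1` this is the coordinate `ζ = Z₁ / Z₂`. -/
def affineChart (i : Fin 2) : OpenPartialHomeomorph CP1 ℂ where
  toFun := coord i
  invFun := affinePoint i
  source := affineSet i
  target := Set.univ
  map_source' _ _ := Set.mem_univ _
  map_target' ζ _ := affinePoint_mem i ζ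
  left_inv' _ hp := affinePoint_coord i hp
  right_inv' ζ _ := coord_affinePoint i ζ
  open_source := isOpen_affineSet i
  open_target := isOpen_univ
  continuousOn_toFun := by
    refine (isQuotientMap_proj.continuousOn_isOpen_iff (isOpen_affineSet i)).2 ?_
    have : coord i ∘ proj = fun v => v.1 (i + 1) / v.1 i := rfl
    rw [this]
    exact ContinuousOn.div ((continuous_apply _).comp continuous_subtype_val).continuousOn
      ((continuous_apply _).comp continuous_subtype_val).continuousOn (fun v hv => hv)
  continuousOn_invFun := by
    refine Continuous.continuousOn ?_
    refine isQuotientMap_proj.continuous.comp (f := fun ζ : ℂ =>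
      (⟨Function.update (fun _ => ζ) i 1, update_ne_zero i ζ⟩ : {v : Fin 2 → ℂ // v ≠ 0})) ?_
    refine Continuous.subtype_mk ?_ _
    exact (continuous_pi fun _ => continuous_id).update i continuous_const

theorem mem_affineSet_or (p : CP1) : p ∈ affineSet 0 ∨ p ∈ affineSet 1 := by
  induction p using Projectivization.ind with
  | h v hv =>
    by_contra hcon
    rw [not_or] at hcon
    obtain ⟨h0, h1⟩ := hcon
    have h0 : v 0 = 0 := not_not.1 h0
    have h1 : v 1 = 0 := not_not.1 h1
    apply hv
    ext j
    fin_cases j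
    · exact h0
    · exact h1

open scoped Classical in
instance : ChartedSpace ℂ CP1 where
  atlas := Set.range affineChart
  chartAt p := if p ∈ affineSet 1 then affineChart 1 else affineChart 0
  mem_chart_source p := by
    by_cases h : p ∈ affineSet 1
    · rw [if_pos h]
      exact h
    · rw [if_neg h]
      exact (mem_affineSet_or p).resolve_right h
  chart_mem_atlas p := by
    by_cases h : p ∈ affineSet 1
    · rw [if_pos h]
      exact ⟨1, rfl⟩
    · rw [if_neg h]
      exact ⟨0, rfl⟩

theorem coord_succ_affinePoint (i : Fin 2) (ζ : ℂ) :
    coord (i + 1) (affinePoint i ζ) = ζ⁻¹ := by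
  have h : i + 1 + 1 = i := by fin_cases i <;> decide
  simp [coord, affinePoint, h]

theorem affinePoint_mem_succ (i : Fin 2) (ζ : ℂ) :
    affinePoint i ζ ∈ affineSet (i + 1) ↔ ζ ≠ 0 := by
  simp [affineSet, affinePoint]

/-- The projective line is a complex manifold. -/
instance : IsManifold 𝓘(ℂ, ℂ) ω CP1 := by
  refine isManifold_of_contDiffOn _ _ _ ?_
  rintro _ _ ⟨i, rfl⟩ ⟨j, rfl⟩
  by_cases hij : j = i
  · subst hij
    refine contDiffOn_id.congr ?_
    intro ζ _
    exact coord_affinePoint j ζ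
  · have hj : j = i + 1 := by
      fin_cases i <;> fin_cases j <;> simp_all
    subst hj
    refine (contDiffOn_id.inv ?_).congr (f := fun ζ : ℂ => ζ⁻¹) ?_
    · intro ζ hζ
      have h2 : affinePoint i ζ ∈ affineSet (i + 1) := by
        simpa [affineChart] using hζ
      exact (affinePoint_mem_succ i ζ).1 h2
    · intro ζ _
      exact coord_succ_affinePoint i ζ

/-- The identification of the projective line with the unit sphere of `ℝ³`,
`[Z₁, Z₂] ↦ (|Z₂|² - |Z₁|², Z₁ Z̄₂ + Z̄₁ Z₂, √-1 (Z̄₁ Z₂ - Z₁ Z̄₂)) / (|Z₁|² + |Z₂|²)`. -/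
def toSphere (p : CP1) : Fin 3 → ℝ :=
  Projectivization.lift
    (fun v : {v : Fin 2 → ℂ // v ≠ 0} =>
      (‖v.1 0‖ ^ 2 + ‖v.1 1‖ ^ 2)⁻¹ •
        ![‖v.1 1‖ ^ 2 - ‖v.1 0‖ ^ 2,
          (v.1 0 * star (v.1 1) + star (v.1 0) * v.1 1).re,
          (Complex.I * (star (v.1 0) * v.1 1 - v.1 0 * star (v.1 1))).re])
    (by
      intro a b t h
      have ht : ‖t‖ ^ 2 ≠ 0 := by
        refine pow_ne_zero _ (norm_ne_zero_iff.2 ?_)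
        rintro rfl
        exact a.2 (by simpa using h)
      have hb : (‖b.1 0‖ ^ 2 + ‖b.1 1‖ ^ 2) ≠ 0 := by
        intro h0
        have e0 : b.1 0 = 0 := by
          have : ‖b.1 0‖ ^ 2 = 0 := by nlinarith [sq_nonneg ‖b.1 0‖, sq_nonneg ‖b.1 1‖]
          simpa using this
        have e1 : b.1 1 = 0 := by
          have : ‖b.1 1‖ ^ 2 = 0 := by nlinarith [sq_nonneg ‖b.1 0‖, sq_nonneg ‖b.1 1‖]
          simpa using this
        apply b.2
        ext j
        fin_cases j
        · exact e0
        · exact e1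
      have key : ∀ x : Fin 3 → ℝ, (‖t * b.1 0‖ ^ 2 + ‖t * b.1 1‖ ^ 2)⁻¹ • (‖t‖ ^ 2 • x)
          = (‖b.1 0‖ ^ 2 + ‖b.1 1‖ ^ 2)⁻¹ • x := by
        intro x
        rw [smul_smul]
        congr 1
        simp only [norm_mul, mul_pow]
        rw [← mul_add, mul_inv, mul_comm, ← mul_assoc, mul_inv_cancel₀ ht, one_mul]
      simp only [h, Pi.smul_apply, smul_eq_mul]
      rw [← key]
      congr 1
      have hn : ‖t‖ ^ 2 = t.re ^ 2 + t.im ^ 2 := by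
        rw [← Complex.normSq_eq_norm_sq, Complex.normSq_apply]
        ring
      ext j
      fin_cases j
      · simp [mul_pow]
        ring
      · simp [hn]
        ring
      · simp [hn]
        ring) p

end CP1

/-! ### Differential forms -/

section Forms

variable {E : Type*} [NormedAddCommGroup E] [NormedSpace ℝ E]
  {H : Type*} [TopologicalSpace H] (I : ModelWithCorners ℝ E H)
  (N : Type*) [TopologicalSpace N] [ChartedSpace H N]

/-- Real differential forms of degree `k` on `N`, without regularity. -/
abbrev DForm (k : ℕ) : Type _ := ∀ x : N, TangentSpace I x [⋀^Fin k]→L[ℝ] ℝ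

/-- Fields of endomorphisms of the tangent bundle of `N`, without regularity. -/
abbrev EndField : Type _ := ∀ x : N, TangentSpace I x →L[ℝ] TangentSpace I x

end Forms

section FormsDefs

variable {E : Type*} [NormedAddCommGroup E] [NormedSpace ℝ E]
  {H : Type*} [TopologicalSpace H] {I : ModelWithCorners ℝ E H}
  {N : Type*} [TopologicalSpace N] [ChartedSpace H N] {k : ℕ}

/-- The expression of a form in the chart of `N` around `x₀`: its pullback under the inverse of
the chart. -/
def DForm.inChart (α : DForm I N k) (x₀ : N) : E → E [⋀^Fin k]→L[ℝ] ℝ := fun y =>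
  (α ((extChartAt I x₀).symm y)).compContinuousLinearMap
    (mfderivWithin 𝓘(ℝ, E) I (extChartAt I x₀).symm (Set.range I) y)

/-- A form is smooth if all its expressions in charts are smooth. -/
def DForm.IsSmooth (α : DForm I N k) : Prop :=
  ∀ x₀ : N, ContDiffOn ℝ ∞ (α.inChart x₀) (extChartAt I x₀).target

/-- The exterior derivative, computed at `x` in the chart around `x`. -/
def DForm.d (α : DForm I N k) : DForm I N (k + 1) := fun x =>
  (extDerivWithin (α.inChart x) (Set.range I) (extChartAt I x x)).compContinuousLinearMap
    (mfderiv I 𝓘(ℝ, E) (extChartAt I x) x)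

/-- The pullback of a form under a map. -/
def DForm.pullback {E' : Type*} [NormedAddCommGroup E'] [NormedSpace ℝ E']
    {H' : Type*} [TopologicalSpace H'] {I' : ModelWithCorners ℝ E' H'}
    {N' : Type*} [TopologicalSpace N'] [ChartedSpace H' N']
    (f : N → N') (α : DForm I' N' k) : DForm I N k := fun x =>
  (α (f x)).compContinuousLinearMap (mfderiv I I' f x)

end FormsDefs

section Power

theorem vec_update {V : Type*} {k : ℕ} [DecidableEq (Fin (2 * k))] (v : Fin (2 * k) → V) (j : Fin (2 * k)) (x : V) :
    ![Function.update v j x ⟨2 * ((j : ℕ) / 2), by omega⟩, Function.update v j x ⟨2 * ((j : ℕ) / 2) + 1, by omega⟩]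
      = Function.update ![v ⟨2 * ((j : ℕ) / 2), by omega⟩, v ⟨2 * ((j : ℕ) / 2) + 1, by omega⟩]
        (⟨(j : ℕ) % 2, by omega⟩ : Fin 2) x := by
  rcases Nat.mod_two_eq_zero_or_one (j : ℕ) with h | h
  · have e0 : (⟨2 * ((j : ℕ) / 2), by omega⟩ : Fin (2 * k)) = j := Fin.ext (by simp only; omega)
    have e1 : (⟨2 * ((j : ℕ) / 2) + 1, by omega⟩ : Fin (2 * k)) ≠ j := by
      intro h'
      have := congrArg Fin.val h'
      simp only at this
      omega
    have e2 : (⟨(j : ℕ) % 2, by omega⟩ : Fin 2) = 0 := Fin.ext h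
    rw [e2, Function.update_of_ne e1, e0, Function.update_self]
    ext l
    fin_cases l <;> simp
  · have e0 : (⟨2 * ((j : ℕ) / 2), by omega⟩ : Fin (2 * k)) ≠ j := by
      intro h'
      have := congrArg Fin.val h'
      simp only at this
      omega
    have e1 : (⟨2 * ((j : ℕ) / 2) + 1, by omega⟩ : Fin (2 * k)) = j := Fin.ext (by simp only; omega)
    have e2 : (⟨(j : ℕ) % 2, by omega⟩ : Fin 2) = 1 := Fin.ext h
    rw [e2, Function.update_of_ne e0, e1, Function.update_self]
    ext l
    fin_cases l <;> simp

variable {V : Type*} [AddCommGroup V] [Module ℝ V] [TopologicalSpace V] {k : ℕ}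

theorem prod_erase_update [DecidableEq (Fin (2 * k))] (α : V [⋀^Fin 2]→L[ℝ] ℝ)
    (v : Fin (2 * k) → V) (j : Fin (2 * k)) (x y : V) (hj : (j : ℕ) / 2 < k) :
    (∏ i ∈ Finset.univ.erase (⟨(j : ℕ) / 2, hj⟩ : Fin k),
      α ![Function.update v j x ⟨2 * i, by omega⟩, Function.update v j x ⟨2 * i + 1, by omega⟩])
    = ∏ i ∈ Finset.univ.erase (⟨(j : ℕ) / 2, hj⟩ : Fin k),
      α ![Function.update v j y ⟨2 * i, by omega⟩, Function.update v j y ⟨2 * i + 1, by omega⟩] := by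
  refine Finset.prod_congr rfl fun i hi => ?_
  have hne : (i : ℕ) ≠ (j : ℕ) / 2 := fun h => Finset.ne_of_mem_erase hi (Fin.ext h)
  have e0 : (⟨2 * i, by omega⟩ : Fin (2 * k)) ≠ j := by
    intro h'
    have := congrArg Fin.val h'
    simp only at this
    omega
  have e1 : (⟨2 * i + 1, by omega⟩ : Fin (2 * k)) ≠ j := by
    intro h'
    have := congrArg Fin.val h'
    simp only at this
    omega
  simp only [Function.update_of_ne e0, Function.update_of_ne e1]

/-- The multilinear map `(v₀, …, v_{2k-1}) ↦ α(v₀, v₁) α(v₂, v₃) ⋯ α(v_{2k-2}, v_{2k-1})`. -/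
def twoFormTensorPow (α : V [⋀^Fin 2]→L[ℝ] ℝ) (k : ℕ) :
    ContinuousMultilinearMap ℝ (fun _ : Fin (2 * k) => V) ℝ where
  toFun v := ∏ i : Fin k, α ![v ⟨2 * i, by omega⟩, v ⟨2 * i + 1, by omega⟩]
  map_update_add' := by
    intro _ v j x y
    have hj : (j : ℕ) / 2 < k := by omega
    simp only [← Finset.mul_prod_erase Finset.univ _ (Finset.mem_univ (⟨(j : ℕ) / 2, hj⟩ : Fin k))]
    rw [prod_erase_update α v j (x + y) x, prod_erase_update α v j y x, ← add_mul,
      vec_update v j (x + y), vec_update v j x, vec_update v j y,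
      α.map_update_add]
  map_update_smul' := by
    intro _ v j c x
    have hj : (j : ℕ) / 2 < k := by omega
    simp only [← Finset.mul_prod_erase Finset.univ _ (Finset.mem_univ (⟨(j : ℕ) / 2, hj⟩ : Fin k))]
    rw [prod_erase_update α v j (c • x) x, vec_update v j (c • x),
      vec_update v j x, α.map_update_smul, smul_mul_assoc]
  cont := by
    refine continuous_finsetProd _ fun i _ => ?_
    refine α.cont.comp (continuous_pi fun l => ?_)
    fin_cases l
    · exact continuous_apply _
    · exact continuous_apply _

/-- The wedge power `α ^ k` of a `2`-form:
`α^k (v₀, …, v_{2k-1}) = 2^{-k} ∑_σ sgn(σ) ∏_{i < k} α(v_{σ(2i)}, v_{σ(2i+1)})`. -/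
def twoFormPow (α : V [⋀^Fin 2]→L[ℝ] ℝ) (k : ℕ) : V [⋀^Fin (2 * k)]→L[ℝ] ℝ :=
  ((2 : ℝ) ^ k)⁻¹ • ContinuousMultilinearMap.alternatization (twoFormTensorPow α k)

end Power

section Hermitian

variable {E : Type*} [NormedAddCommGroup E] [NormedSpace ℝ E]
  {H : Type*} [TopologicalSpace H] {I : ModelWithCorners ℝ E H}
  {N : Type*} [TopologicalSpace N] [ChartedSpace H N]

/-- The wedge power `α ^ k` of a differential `2`-form. -/
def DForm.pow (α : DForm I N 2) (k : ℕ) : DForm I N (2 * k) := fun x => twoFormPow (α x) k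

/-- A complex structure on a smooth manifold: a smooth almost complex structure whose Nijenhuis
tensor `N(V, W) = [JV, JW] - J[JV, W] - J[V, JW] - [V, W]` vanishes. -/
structure IsComplexStructure [IsManifold I ∞ N] (J : EndField I N) : Prop where
  smooth : ContMDiff I (I.prod 𝓘(ℝ, E →L[ℝ] E)) ∞
    (fun x => TotalSpace.mk' (E →L[ℝ] E) (E := fun x : N => TangentSpace I x →L[ℝ] TangentSpace I x)
      x (J x))
  sq : ∀ (x : N) (v : TangentSpace I x), J x (J x v) = -v
  integrable : ∀ (x : N) (V W : ∀ y : N, TangentSpace I y),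
    ContMDiffAt I I.tangent ∞ (fun y => (V y : TangentBundle I N)) x →
    ContMDiffAt I I.tangent ∞ (fun y => (W y : TangentBundle I N)) x →
    mlieBracket I (fun y => J y (V y)) (fun y => J y (W y)) x
      - J x (mlieBracket I (fun y => J y (V y)) W x)
      - J x (mlieBracket I V (fun y => J y (W y)) x)
      - mlieBracket I V W x = 0

/-- A smooth, positive definite real `(1,1)`-form with respect to `J`, that is, the fundamental
form of a Hermitian metric. -/
structure IsPositiveForm (J : EndField I N) (α : DForm I N 2) : Prop where
  smooth : α.IsSmooth
  invariant : ∀ (x : N) (v w : TangentSpace I x), α x ![J x v, J x w] = α x ![v, w]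
  pos : ∀ (x : N) (v : TangentSpace I x), v ≠ 0 → 0 < α x ![v, J x v]

/-- Kähler forms: closed positive definite `(1,1)`-forms. -/
structure IsKahlerForm (J : EndField I N) (α : DForm I N 2) : Prop
    extends IsPositiveForm J α where
  closed : α.d = 0

/-- Balanced metrics on a manifold of complex dimension `p`: positive definite `(1,1)`-forms `α`
with `d (α ^ (p - 1)) = 0`. -/
structure IsBalancedMetric (J : EndField I N) (p : ℕ) (α : DForm I N 2) : Prop
    extends IsPositiveForm J α where
  finrank_eq : finrank ℝ E = 2 * p
  closed_pow : (α.pow (p - 1)).d = 0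

end Hermitian

/-! ### Hypercomplex and hyper-Kähler manifolds -/

/-- A hypercomplex structure `(I, J, K)` on `M` with a compatible Riemannian metric `g`. -/
structure HypercomplexStructure {E : Type*} [NormedAddCommGroup E] [NormedSpace ℝ E]
    (M : Type*) [TopologicalSpace M] [ChartedSpace E M] [IsManifold 𝓘(ℝ, E) ∞ M] where
  /-- the first complex structure -/
  I : EndField 𝓘(ℝ, E) M
  /-- the second complex structure -/
  J : EndField 𝓘(ℝ, E) M
  /-- the third complex structure -/
  K : EndField 𝓘(ℝ, E) M
  /-- the compatible Riemannian metric -/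
  g : ContMDiffRiemannianMetric 𝓘(ℝ, E) ∞ E (fun x : M => TangentSpace 𝓘(ℝ, E) x)
  isComplexStructure_I : IsComplexStructure I
  isComplexStructure_J : IsComplexStructure J
  isComplexStructure_K : IsComplexStructure K
  I_J : ∀ (x : M) (v : TangentSpace 𝓘(ℝ, E) x), I x (J x v) = K x v
  J_K : ∀ (x : M) (v : TangentSpace 𝓘(ℝ, E) x), J x (K x v) = I x v
  K_I : ∀ (x : M) (v : TangentSpace 𝓘(ℝ, E) x), K x (I x v) = J x v
  g_I : ∀ (x : M) (v w : TangentSpace 𝓘(ℝ, E) x), g.inner x (I x v) (I x w) = g.inner x v w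
  g_J : ∀ (x : M) (v w : TangentSpace 𝓘(ℝ, E) x), g.inner x (J x v) (J x w) = g.inner x v w
  g_K : ∀ (x : M) (v w : TangentSpace 𝓘(ℝ, E) x), g.inner x (K x v) (K x w) = g.inner x v w

namespace HypercomplexStructure

variable {E : Type*} [NormedAddCommGroup E] [NormedSpace ℝ E]
  {M : Type*} [TopologicalSpace M] [ChartedSpace E M] [IsManifold 𝓘(ℝ, E) ∞ M]
  (S : HypercomplexStructure (E := E) M)

/-- The two-form `(v, w) ↦ g (A v, w)` for a `g`-orthogonal endomorphism `A` with `A² = -1`. -/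
def twoFormOf (A : EndField 𝓘(ℝ, E) M) (hA : ∀ x v, A x (A x v) = -v)
    (hg : ∀ x v w, S.g.inner x (A x v) (A x w) = S.g.inner x v w) : DForm 𝓘(ℝ, E) M 2 := fun x =>
  { toFun := fun v => S.g.inner x (A x (v 0)) (v 1)
    map_update_add' := by
      intro _ v i y z
      fin_cases i <;> simp
    map_update_smul' := by
      intro _ v i c y
      fin_cases i <;> simp
    map_eq_zero_of_eq' := by
      intro v i j hv hij
      have h01 : v 0 = v 1 := by
        fin_cases i <;> fin_cases j <;> simp_all
      have h1 := hg x (A x (v 1)) (v 1)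
      rw [hA, S.g.symm x (A x (v 1)) (v 1)] at h1
      simp only [map_neg, neg_apply] at h1
      rw [h01, S.g.symm]
      linarith
    cont := by fun_prop }

/-- `ω_I = g (I ·, ·)`. -/
def omegaI : DForm 𝓘(ℝ, E) M 2 := S.twoFormOf S.I S.isComplexStructure_I.sq S.g_I

/-- `ω_J = g (J ·, ·)`. -/
def omegaJ : DForm 𝓘(ℝ, E) M 2 := S.twoFormOf S.J S.isComplexStructure_J.sq S.g_J

/-- `ω_K = g (K ·, ·)`. -/
def omegaK : DForm 𝓘(ℝ, E) M 2 := S.twoFormOf S.K S.isComplexStructure_K.sq S.g_K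

/-- The hypercomplex structure with its metric is hyper-Kähler if the metric is Kähler with respect
to each of `I`, `J`, `K`. -/
structure IsHyperKahler : Prop where
  isKahlerForm_I : IsKahlerForm S.I S.omegaI
  isKahlerForm_J : IsKahlerForm S.J S.omegaJ
  isKahlerForm_K : IsKahlerForm S.K S.omegaK

end HypercomplexStructure

/-! ### Complex manifolds as real manifolds -/

section Complex

variable {F : Type*} [NormedAddCommGroup F] [NormedSpace ℂ F]
  {Q : Type*} [TopologicalSpace Q] [ChartedSpace F Q]

/-- The real smooth manifold underlying a complex manifold. -/
instance [hQ : IsManifold 𝓘(ℂ, F) ω Q] : IsManifold 𝓘(ℝ, F) ∞ Q := by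
  refine isManifold_of_contDiffOn _ _ _ ?_
  intro e e' he he'
  have h := hQ.compatible he he'
  rw [contDiffGroupoid, mem_groupoid_of_pregroupoid] at h
  have h1 : ContDiffOn ℂ ω (𝓘(ℂ, F) ∘ (e.symm ≫ₕ e') ∘ 𝓘(ℂ, F).symm)
    (𝓘(ℂ, F).symm ⁻¹' (e.symm ≫ₕ e').source ∩ Set.range 𝓘(ℂ, F)) := h.1
  exact (h1.restrict_scalars ℝ).of_le le_top

variable (F Q) in
/-- The complex structure of a complex manifold: multiplication by `√-1` on tangent spaces. -/
def stdComplexStructure : EndField 𝓘(ℝ, F) Q := fun _ =>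
  (((Complex.I • ContinuousLinearMap.id ℂ F : F →L[ℂ] F)).restrictScalars ℝ : F →L[ℝ] F)

end Complex

/-! ### The higher dimensional analog of the twistor space -/

section Twistor

variable {E : Type*} [NormedAddCommGroup E] [NormedSpace ℝ E]
  {M : Type*} [TopologicalSpace M] [ChartedSpace E M] [IsManifold 𝓘(ℝ, E) ∞ M]
  {F : Type*} [NormedAddCommGroup F] [NormedSpace ℂ F]
  {Q : Type*} [TopologicalSpace Q] [ChartedSpace F Q]
  (S : HypercomplexStructure (E := E) M) (h : Q → CP1)

/-- The endomorphism `I_M` at `(m, q)`: the combination of `I`, `J`, `K` given by the point of the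
sphere corresponding to `h q`. -/
def twistorIM (x : M × Q) : TangentSpace 𝓘(ℝ, E) x.1 →L[ℝ] TangentSpace 𝓘(ℝ, E) x.1 :=
  (h x.2).toSphere 0 • S.I x.1 + (h x.2).toSphere 1 • S.J x.1 + (h x.2).toSphere 2 • S.K x.1

/-- The endomorphism field `(I_M, I_Q)` on `X = M × Q`, with respect to the splitting
`T_{(m, q)} X = T_m M × T_q Q`. -/
def twistorStructure : EndField (𝓘(ℝ, E).prod 𝓘(ℝ, F)) (M × Q) := fun x =>
  ContinuousLinearMap.prodMap (M₁ := TangentSpace 𝓘(ℝ, E) x.1) (M₂ := TangentSpace 𝓘(ℝ, E) x.1)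
    (M₃ := TangentSpace 𝓘(ℝ, F) x.2) (M₄ := TangentSpace 𝓘(ℝ, F) x.2)
    (twistorIM S h x) (stdComplexStructure F Q x.2)

/-- The form `ω_M` on `X = M × Q`: the combination of (the pullbacks of) `ω_I`, `ω_J`, `ω_K` with
the coefficients of `I_M`, so that `ω_M = g (I_M ·, ·)`. -/
def twistorOmegaM : DForm (𝓘(ℝ, E).prod 𝓘(ℝ, F)) (M × Q) 2 := fun x =>
  (h x.2).toSphere 0 • S.omegaI.pullback Prod.fst x
    + (h x.2).toSphere 1 • S.omegaJ.pullback Prod.fst x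
    + (h x.2).toSphere 2 • S.omegaK.pullback Prod.fst x

/-- The form `ω_M + t ω_Q` on `X = M × Q`. -/
def twistorForm (ωQ : DForm 𝓘(ℝ, F) Q 2) (t : ℝ) : DForm (𝓘(ℝ, E).prod 𝓘(ℝ, F)) (M × Q) 2 :=
  fun x => twistorOmegaM S h x + t • ωQ.pullback Prod.snd x

end Twistor

end

/-!
All three claims are checked at a single point of `X = M × Q`, in the product of charts centred
there; the derivative of a centred chart at its centre is the identity, so that no coordinate
changes enter. The identification of the projective line with the sphere turns `h` into a function
`s = (a, b, c)` with `|s| = 1`, hence `s · ds = 0`, and holomorphy becomes the Cauchy–Riemann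
equation `ds (√-1 u) = s × ds u` (`fderiv_sphereInChart_mulI`).

*Integrability.* For a constant point `(a, b, c)` of the sphere and a vector `β ≠ 0` orthogonal to
it, the forms `ω_β` and `ω_β (I_M ·, ·)` are both combinations of `ω_I`, `ω_J`, `ω_K`, hence closed.
A nondegenerate closed form `σ` for which `σ (A ·, ·)` is a closed form forces the Nijenhuis tensor
of `A` to vanish (`nijenhuis_eq_zero_of_closed`). On the product, the terms with derivatives of `s`
cancel by the Cauchy–Riemann equation and the quaternion relations (`nijenhuis_prod_eq_zero`).

*Balancedness.* Since `ω_I`, `ω_J`, `ω_K`, `ω_Q` are closed, the exterior derivative of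
`ω_M + t ω_Q` is `da ∧ ω_I + db ∧ ω_J + dc ∧ ω_K` (`extDeriv_inChart_twistorForm`). Its contraction
with `e` and `I_M e`, for `e` tangent to `M`, is `|e|² (a da + b db + c dc) = 0`, and its
contraction with two vectors tangent to `Q` vanishes as well. So there is a unitary basis, adapted
to the splitting of the tangent space, such that the contraction of the exterior derivative with
each pair of basis vectors `e_j`, `I e_j` is zero. This is enough for `d (α ^ (p - 1)) = 0` in
complex dimension `p`: among `2 p - 1` different basis vectors there are `p - 1` complete pairs
`e_j`, `I e_j`, and contracting with them reduces the power by one each time, until `d 1 = 0` is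
left (`extDeriv_twoFormPow_eq_zero`).

*Not Kähler.* If `da ∧ ω_I + db ∧ ω_J + dc ∧ ω_K = 0`, then contraction with a vector `u` tangent to
`Q` gives `da(u) ω_I + db(u) ω_J + dc(u) ω_K = 0`. A combination of these forms with nonzero
coefficients is nondegenerate (`HypercomplexStructure.formInChart_nondegenerate`), so `ds = 0`
everywhere, and `h` is locally constant because the projective line embeds into the sphere.
-/

noncomputable section

-- spaces of linear maps with values in alternating maps need nested instance problems
set_option maxSynthPendingDepth 3

/-! ### Expansion of alternating sums and of wedge powers -/

section WedgePowers

open ContinuousAlternatingMap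

/-- Permutations of `Fin (n + 1)` sorted by the image `i` of `0`, as in the Laplace expansion. -/
theorem sum_perm_fin_succ {V : Type*} {n : ℕ} (f : (Fin (n + 1) → V) → ℝ) (v : Fin (n + 1) → V) :
    ∑ σ : Equiv.Perm (Fin (n + 1)), Equiv.Perm.sign σ • f (v ∘ σ) =
      ∑ i : Fin (n + 1), (-1 : ℤ) ^ (i : ℕ) • ∑ τ : Equiv.Perm (Fin n),
        Equiv.Perm.sign τ • f (Matrix.vecCons (v i) (i.removeNth v ∘ τ)) := by
  rw [← Equiv.Perm.decomposeFin.symm.sum_comp, Fintype.sum_prod_type]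
  refine Finset.sum_congr rfl fun p _ => ?_
  have key : ∀ (τ ρ : Equiv.Perm (Fin n)),
      (∀ j, Equiv.swap 0 p (τ j).succ = p.succAbove (ρ j)) →
      v ∘ Equiv.Perm.decomposeFin.symm (p, τ) = Matrix.vecCons (v p) (p.removeNth v ∘ ρ) := by
    intro τ ρ hρ
    funext j
    refine Fin.cases ?_ (fun j => ?_) j
    · simp
    · simp [hρ, Fin.removeNth]
  induction p using Fin.cases with
  | zero =>
    simp only [Equiv.Perm.decomposeFin.symm_sign, if_true, one_mul, Fin.val_zero, pow_zero,
      one_smul]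
    refine Finset.sum_congr rfl fun τ _ => ?_
    rw [key τ τ (by simp)]
  | succ i =>
    rw [Finset.smul_sum,
      ← Equiv.sum_comp (Equiv.mulLeft (Fin.cycleRange i))
        (fun τ => (-1 : ℤ) ^ ((i.succ : Fin (n + 1)) : ℕ) • (Equiv.Perm.sign τ •
          f (Matrix.vecCons (v i.succ) (i.succ.removeNth v ∘ τ))))]
    refine Finset.sum_congr rfl fun τ _ => ?_
    rw [key τ (Fin.cycleRange i * τ) (by simp [Fin.succAbove_cycleRange])]
    simp only [Equiv.Perm.decomposeFin.symm_sign, Fin.succ_ne_zero, if_false, Equiv.coe_mulLeft,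
      Equiv.Perm.sign_mul, Fin.sign_cycleRange, Fin.val_succ, Units.smul_def, smul_smul]
    congr 1
    push_cast
    rw [pow_succ]
    have : ((-1 : ℤ) ^ (i : ℕ)) * (-1) ^ (i : ℕ) = 1 := by rw [← mul_pow]; simp
    linear_combination (Equiv.Perm.sign τ : ℤ) * this

variable {V : Type*} [NormedAddCommGroup V] [NormedSpace ℝ V]

/-- The wedge product `l ∧ η` of a `1`-form and an `n`-form. -/
def wedgeOne {n : ℕ} (l : V →L[ℝ] ℝ) (η : V [⋀^Fin n]→L[ℝ] ℝ) : V [⋀^Fin (n + 1)]→L[ℝ] ℝ :=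
  alternatizeUncurryFin (l.smulRight η)

theorem wedgeOne_apply {n : ℕ} (l : V →L[ℝ] ℝ) (η : V [⋀^Fin n]→L[ℝ] ℝ) (v : Fin (n + 1) → V) :
    wedgeOne l η v = ∑ i : Fin (n + 1), (-1 : ℤ) ^ (i : ℕ) • (l (v i) * η (i.removeNth v)) := by
  simp [wedgeOne, alternatizeUncurryFin_apply]

/-- Contraction with a vector, as a continuous linear operation on alternating maps. -/
def contractL {n : ℕ} (x : V) : (V [⋀^Fin (n + 1)]→L[ℝ] ℝ) →L[ℝ] (V [⋀^Fin n]→L[ℝ] ℝ) :=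
  ContinuousLinearMap.apply ℝ _ x ∘L (curryLeftLI (𝕜 := ℝ) (E := V) (F := ℝ)).toContinuousLinearMap

@[simp]
theorem contractL_apply {n : ℕ} (x : V) (η : V [⋀^Fin (n + 1)]→L[ℝ] ℝ) (v : Fin n → V) :
    contractL x η v = η (Matrix.vecCons x v) := rfl

/-- Contraction anticommutes with alternatization, up to the term where the vector is inserted into
the first slot. -/
theorem alternatizeUncurryFin_vecCons {n : ℕ} (f : V →L[ℝ] V [⋀^Fin (n + 1)]→L[ℝ] ℝ) (x : V)
    (v : Fin (n + 1) → V) :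
    alternatizeUncurryFin f (Matrix.vecCons x v) =
      f x v - alternatizeUncurryFin (contractL x ∘L f) v := by
  rw [alternatizeUncurryFin_apply, Fin.sum_univ_succ, alternatizeUncurryFin_apply]
  simp only [Fin.val_zero, pow_zero, one_smul, Matrix.cons_val_zero, Fin.val_succ, pow_succ,
    Matrix.cons_val_succ, sub_eq_add_neg, ← Finset.sum_neg_distrib]
  congr 1
  refine Finset.sum_congr rfl fun i _ => ?_
  rw [mul_neg_one, neg_smul]
  congr 2
  rw [ContinuousLinearMap.comp_apply, contractL_apply]
  congr 1
  exact Fin.cons_comp_succ_succAbove x v i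

/-- A `2`-form as a bilinear map. -/
def twoFormL : (V [⋀^Fin 2]→L[ℝ] ℝ) →L[ℝ] V →L[ℝ] V →L[ℝ] ℝ :=
  ContinuousLinearMap.compL ℝ V _ _
    (ofSubsingletonLIE (𝕜 := ℝ) (E := V) (F := ℝ) (0 : Fin 1)).symm.toContinuousLinearEquiv.toContinuousLinearMap ∘L
    (curryLeftLI (𝕜 := ℝ) (E := V) (F := ℝ) (n := 1)).toContinuousLinearMap

@[simp]
theorem twoFormL_apply (α : V [⋀^Fin 2]→L[ℝ] ℝ) (u w : V) : twoFormL α u w = α ![u, w] := by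
  change α (Matrix.vecCons u (fun _ => w)) = _
  congr 1
  ext i
  fin_cases i <;> rfl

theorem twoForm_swap (α : V [⋀^Fin 2]→L[ℝ] ℝ) (u w : V) : α ![u, w] = -α ![w, u] := by
  have h : α (![w, u] ∘ Equiv.swap 0 1) = -α ![w, u] :=
    α.map_swap ![w, u] (i := 0) (j := 1) (by simp)
  rw [← h]
  congr 1
  ext i
  fin_cases i <;> rfl

theorem twoForm_self (α : V [⋀^Fin 2]→L[ℝ] ℝ) (u : V) : α ![u, u] = 0 :=
  α.map_eq_zero_of_eq ![u, u] (i := 0) (j := 1) rfl (by simp)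

theorem twoForm_zero_left  (α : V [⋀^Fin 2]→L[ℝ] ℝ) (v : V) : α ![0, v] = 0 :=
  α.map_coord_zero 0 rfl

theorem twoForm_zero_right  (α : V [⋀^Fin 2]→L[ℝ] ℝ) (v : V) : α ![v, 0] = 0 :=
  α.map_coord_zero 1 rfl

/-- The wedge product with a `1`-form as a continuous bilinear operation. -/
def wedgeOneL (n : ℕ) :
    (V →L[ℝ] ℝ) →L[ℝ] (V [⋀^Fin n]→L[ℝ] ℝ) →L[ℝ] (V [⋀^Fin (n + 1)]→L[ℝ] ℝ) :=
  ContinuousLinearMap.compL ℝ _ _ _ (alternatizeUncurryFinCLM ℝ V ℝ) ∘L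
    ContinuousLinearMap.smulRightL ℝ V (V [⋀^Fin n]→L[ℝ] ℝ)

@[simp]
theorem wedgeOneL_apply {n : ℕ} (l : V →L[ℝ] ℝ) (η : V [⋀^Fin n]→L[ℝ] ℝ) :
    wedgeOneL n l η = wedgeOne l η := rfl

theorem wedgeOne_vecCons {n : ℕ} (l : V →L[ℝ] ℝ) (η : V [⋀^Fin (n + 1)]→L[ℝ] ℝ) (x : V)
    (v : Fin (n + 1) → V) :
    wedgeOne l η (Matrix.vecCons x v) = l x * η v - wedgeOne l (contractL x η) v := by
  rw [wedgeOne, alternatizeUncurryFin_vecCons, wedgeOne]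
  congr 2

/-- Wedge products with `1`-forms anticommute, in the form where the other `1`-forms are the slot
of an alternatization. -/
theorem alternatizeUncurryFin_wedgeOne {n : ℕ} (l : V →L[ℝ] ℝ) (f : V →L[ℝ] V [⋀^Fin n]→L[ℝ] ℝ) :
    alternatizeUncurryFin (wedgeOneL n l ∘L f) = -wedgeOne l (alternatizeUncurryFin f) := by
  let F : V →L[ℝ] V →L[ℝ] V [⋀^Fin n]→L[ℝ] ℝ := ContinuousLinearMap.smulRightL ℝ V _ l ∘L f
  let G : V →L[ℝ] V →L[ℝ] V [⋀^Fin n]→L[ℝ] ℝ := F.flip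
  let H : V →L[ℝ] V →L[ℝ] V [⋀^Fin n]→L[ℝ] ℝ := F + G
  have h := alternatizeUncurryFin_alternatizeUncurryFinCLM_comp_of_symmetric (f := H)
    (fun x y => by simp [H, G, add_comm])
  rw [ContinuousLinearMap.comp_add, alternatizeUncurryFin_add] at h
  have hG : l.smulRight (alternatizeUncurryFin f) = alternatizeUncurryFinCLM ℝ V ℝ ∘L G := by
    ext1 w
    change l w • alternatizeUncurryFin f = alternatizeUncurryFin (G w)
    rw [← alternatizeUncurryFin_smul]
    rfl
  have hF : wedgeOneL n l ∘L f = alternatizeUncurryFinCLM ℝ V ℝ ∘L F := rfl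
  rw [← add_eq_zero_iff_eq_neg, wedgeOne, hG, hF, h]

theorem wedgeOne_wedgeOne {n : ℕ} (l m : V →L[ℝ] ℝ) (η : V [⋀^Fin n]→L[ℝ] ℝ) :
    wedgeOne l (wedgeOne m η) = -wedgeOne m (wedgeOne l η) := by
  rw [wedgeOne, show l.smulRight (wedgeOne m η) = wedgeOneL n m ∘L l.smulRight η by ext; simp,
    alternatizeUncurryFin_wedgeOne]
  rfl

theorem wedgeOne_eq_zero {n : ℕ} {l : V →L[ℝ] ℝ} {v : Fin (n + 1) → V} (hl : ∀ i, l (v i) = 0)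
    (η : V [⋀^Fin n]→L[ℝ] ℝ) : wedgeOne l η v = 0 := by
  simp [wedgeOne_apply, hl]

/-- The alternating sum of `α ⊗ ⋯ ⊗ α`, which is `2 ^ k α ^ k`. -/
def twoFormAlt (α : V [⋀^Fin 2]→L[ℝ] ℝ) (k : ℕ) : V [⋀^Fin (2 * k)]→L[ℝ] ℝ :=
  ContinuousMultilinearMap.alternatization (twoFormTensorPow α k)

theorem twoFormTensorPow_succ (α : V [⋀^Fin 2]→L[ℝ] ℝ) (k : ℕ) (u w : V) (v : Fin (2 * k) → V) :
    twoFormTensorPow α (k + 1) (Matrix.vecCons u (Matrix.vecCons w v)) =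
      α ![u, w] * twoFormTensorPow α k v := by
  change ∏ i : Fin (k + 1), _ = _ * ∏ i : Fin k, _
  rw [Fin.prod_univ_succ]
  rfl

/-- Recursion in `k`: the two vectors inserted into the first factor `α` are split off one after the
other. -/
theorem twoFormAlt_succ (α : V [⋀^Fin 2]→L[ℝ] ℝ) (k : ℕ) :
    twoFormAlt α (k + 1) =
      alternatizeUncurryFin ((wedgeOneL (2 * k)).flip (twoFormAlt α k) ∘L twoFormL α) := by
  ext v
  rw [twoFormAlt, ContinuousMultilinearMap.alternatization_apply_apply,
    alternatizeUncurryFin_apply]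
  refine (sum_perm_fin_succ (n := 2 * k + 1) (fun v => twoFormTensorPow α (k + 1) v) v).trans ?_
  refine Finset.sum_congr rfl fun i _ => ?_
  congr 1
  refine (sum_perm_fin_succ (n := 2 * k) (fun w => twoFormTensorPow α (k + 1)
    (Matrix.vecCons (v i) w)) (i.removeNth v)).trans ?_
  simp only [ContinuousLinearMap.comp_apply, ContinuousLinearMap.flip_apply, wedgeOneL_apply,
    wedgeOne_apply]
  refine Finset.sum_congr rfl fun j _ => ?_
  rw [twoFormAlt, ContinuousMultilinearMap.alternatization_apply_apply, Finset.mul_sum]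
  congr 1
  refine Finset.sum_congr rfl fun τ _ => ?_
  rw [twoFormTensorPow_succ, twoFormL_apply, mul_smul_comm]

theorem contractL_twoFormAlt (α : V [⋀^Fin 2]→L[ℝ] ℝ) (k : ℕ) (x : V) :
    contractL (n := 2 * k + 1) x (twoFormAlt α (k + 1)) =
      (2 * (k + 1) : ℝ) • wedgeOne (twoFormL α x) (twoFormAlt α k) := by
  induction k with
  | zero =>
    ext v
    rw [contractL_apply, twoFormAlt_succ, alternatizeUncurryFin_apply]
    simp only [ContinuousLinearMap.comp_apply, ContinuousLinearMap.flip_apply, wedgeOneL_apply,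
      ContinuousAlternatingMap.smul_apply]
    have e : ∀ w : Fin (2 * 0) → V, twoFormAlt α 0 w = 1 := fun w => by
      have h1 : ∀ w : Fin (2 * 0) → V, twoFormTensorPow α 0 w = 1 := fun w => rfl
      simp [twoFormAlt, ContinuousMultilinearMap.alternatization_apply_apply, h1]
    have e1 : (Fin.removeNth 1 (Matrix.vecCons x v) : Fin 1 → V) 0 = x := rfl
    simp only [e, Fin.sum_univ_succ, Fin.isValue, Fin.val_zero, pow_zero,
      Matrix.cons_val_zero, wedgeOne_apply, Finset.univ_unique, Fin.default_eq_zero,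
      Finset.sum_singleton, one_smul, twoFormL_apply, smul_eq_mul, Fin.val_succ, pow_one, neg_smul,
      Matrix.cons_val_succ, zero_add, Fin.succ_zero_eq_one, e1, Nat.mul_zero, Finset.univ_eq_empty,
      Finset.sum_empty, add_zero]
    rw [twoForm_swap α (v 0) x]
    change α ![x, v 0] * 1 + _ = _
    push_cast
    ring
  | succ k ih =>
    ext v
    have h1 : contractL x ∘L ((wedgeOneL (2 * (k + 1))).flip (twoFormAlt α (k + 1)) ∘L twoFormL α)
        = -(twoFormL α x).smulRight (twoFormAlt α (k + 1)) +
          (2 * (k + 1) : ℝ) • (wedgeOneL (2 * k + 1) (twoFormL α x) ∘L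
            ((wedgeOneL (2 * k)).flip (twoFormAlt α k) ∘L twoFormL α)) := by
      ext u w
      simp only [ContinuousLinearMap.comp_apply, ContinuousLinearMap.flip_apply, wedgeOneL_apply,
        contractL_apply]
      rw [wedgeOne_vecCons (n := 2 * k + 1), ih, ← wedgeOneL_apply, map_smul, wedgeOneL_apply,
        wedgeOne_wedgeOne (twoFormL α u)]
      simp [twoForm_swap α u x]
    rw [contractL_apply, twoFormAlt_succ, alternatizeUncurryFin_vecCons (n := 2 * (k + 1)), h1,
      alternatizeUncurryFin_add, alternatizeUncurryFin_smul, alternatizeUncurryFin_wedgeOne,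
      ← twoFormAlt_succ]
    rw [show -(twoFormL α x).smulRight (twoFormAlt α (k + 1)) =
      (-1 : ℝ) • (twoFormL α x).smulRight (twoFormAlt α (k + 1)) by simp, alternatizeUncurryFin_smul]
    simp only [ContinuousLinearMap.comp_apply, ContinuousLinearMap.flip_apply, wedgeOneL_apply,
      ContinuousAlternatingMap.add_apply, ContinuousAlternatingMap.smul_apply,
      ContinuousAlternatingMap.neg_apply, smul_eq_mul]
    change _ - (-1 * wedgeOne (twoFormL α x) (twoFormAlt α (k + 1)) v + _) = _
    push_cast
    ring

/-- Contraction of a wedge power with a vector `x`: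
`α ^ (k + 1) (x, ·) = (k + 1) α (x, ·) ∧ α ^ k`. -/
theorem contractL_twoFormPow (α : V [⋀^Fin 2]→L[ℝ] ℝ) (k : ℕ) (x : V) :
    contractL (n := 2 * k + 1) x (twoFormPow α (k + 1)) =
      (k + 1 : ℝ) • wedgeOne (twoFormL α x) (twoFormPow α k) := by
  change contractL (n := 2 * k + 1) x (((2 : ℝ) ^ (k + 1))⁻¹ • twoFormAlt α (k + 1)) =
    (k + 1 : ℝ) • wedgeOne (twoFormL α x) (((2 : ℝ) ^ k)⁻¹ • twoFormAlt α k)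
  rw [map_smul, contractL_twoFormAlt, ← wedgeOneL_apply, ← wedgeOneL_apply,
    map_smul (wedgeOneL (2 * k) (twoFormL α x)), smul_smul, smul_smul]
  congr 1
  field_simp
  ring

end WedgePowers

/-! ### Exterior derivatives of wedge powers -/

section ExtDerivPow

open ContinuousAlternatingMap

variable {V : Type*} [NormedAddCommGroup V] [NormedSpace ℝ V]

/-- On a finite-dimensional space, a family of alternating maps is `C^n` if its values on fixed
vectors are. -/
theorem contDiffWithinAt_alternatingMap [FiniteDimensional ℝ V] {X : Type*} [NormedAddCommGroup X]
    [NormedSpace ℝ X] {k : ℕ} {n : WithTop ℕ∞} {f : X → V [⋀^Fin k]→L[ℝ] ℝ} {s : Set X} {x : X}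
    (hf : ∀ v : Fin k → V, ContDiffWithinAt ℝ n (fun y => f y v) s x) :
    ContDiffWithinAt ℝ n f s x := by
  let b := Module.finBasis ℝ V
  let L : (V [⋀^Fin k]→L[ℝ] ℝ) →L[ℝ] ((Fin k → Fin (finrank ℝ V)) → ℝ) :=
    ContinuousLinearMap.pi fun s => ContinuousAlternatingMap.apply ℝ V ℝ (fun i => b (s i))
  have hL : Function.Injective L := by
    intro α β h
    have h2 : α.toAlternatingMap.toMultilinearMap = β.toAlternatingMap.toMultilinearMap :=
      Module.Basis.ext_multilinear (fun _ => b) fun s => congrFun h s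
    ext v
    exact congrArg (fun m : MultilinearMap ℝ (fun _ : Fin k => V) ℝ => m v) h2
  obtain ⟨P, hP⟩ := L.toLinearMap.exists_leftInverse_of_injective (LinearMap.ker_eq_bot.2 hL)
  have h3 : f = fun y => P.toContinuousLinearMap (L (f y)) := by
    funext y
    exact (LinearMap.congr_fun hP (f y)).symm
  rw [h3]
  refine P.toContinuousLinearMap.contDiff.contDiffAt.comp_contDiffWithinAt x ?_
  exact contDiffWithinAt_pi.2 fun s => hf _

theorem twoFormPow_apply (α : V [⋀^Fin 2]→L[ℝ] ℝ) (k : ℕ) (v : Fin (2 * k) → V) :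
    twoFormPow α k v = ((2 : ℝ) ^ k)⁻¹ * ∑ σ : Equiv.Perm (Fin (2 * k)), Equiv.Perm.sign σ •
      ∏ i : Fin k, α ![v (σ ⟨2 * i, by omega⟩), v (σ ⟨2 * i + 1, by omega⟩)] := by
  rw [twoFormPow, ContinuousAlternatingMap.smul_apply,
    ContinuousMultilinearMap.alternatization_apply_apply]
  rfl

theorem contDiffAt_twoFormPow [FiniteDimensional ℝ V] {X : Type*} [NormedAddCommGroup X]
    [NormedSpace ℝ X] {n : WithTop ℕ∞} {f : X → V [⋀^Fin 2]→L[ℝ] ℝ} {x : X}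
    (hf : ContDiffAt ℝ n f x) (k : ℕ) : ContDiffAt ℝ n (fun y => twoFormPow (f y) k) x := by
  refine contDiffWithinAt_alternatingMap fun v => ?_
  simp only [twoFormPow_apply]
  refine contDiffWithinAt_const.mul (ContDiffWithinAt.sum fun σ _ => ?_)
  refine ContDiffWithinAt.const_smul (Equiv.Perm.sign σ) (contDiffWithinAt_prod fun i _ => ?_)
  exact (ContinuousAlternatingMap.apply ℝ V ℝ _).contDiff.contDiffAt.comp_contDiffWithinAt x hf

/-- The exterior derivative of a `2`-form, in terms of the derivatives of its coefficients. -/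
theorem extDeriv_two_apply {β : V → V [⋀^Fin 2]→L[ℝ] ℝ} {y : V} (u v w : V) :
    extDeriv β y ![u, v, w] =
      fderiv ℝ β y u ![v, w] - fderiv ℝ β y v ![u, w] + fderiv ℝ β y w ![u, v] := by
  rw [extDeriv, alternatizeUncurryFin_apply, Fin.sum_univ_three]
  have h0 : (0 : Fin 3).removeNth ![u, v, w] = ![v, w] := by ext i; fin_cases i <;> rfl
  have h1 : (1 : Fin 3).removeNth ![u, v, w] = ![u, w] := by ext i; fin_cases i <;> rfl
  have h2 : (2 : Fin 3).removeNth ![u, v, w] = ![u, v] := by ext i; fin_cases i <;> rfl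
  rw [h0, h1, h2]
  simp
  ring

/-- The derivative of the contraction formula for wedge powers. -/
theorem contractL_comp_fderiv_twoFormPow [FiniteDimensional ℝ V]
    {β : V → V [⋀^Fin 2]→L[ℝ] ℝ} {y : V}
    (hβ : ContDiffAt ℝ 1 β y) (k : ℕ) (x : V) :
    contractL (n := 2 * k + 1) x ∘L fderiv ℝ (fun z => twoFormPow (β z) (k + 1)) y =
      (k + 1 : ℝ) • ((wedgeOneL (2 * k)).flip (twoFormPow (β y) k) ∘L
        (ContinuousLinearMap.apply ℝ _ x ∘L twoFormL ∘L fderiv ℝ β y)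
        + wedgeOneL (2 * k) (twoFormL (β y) x) ∘L fderiv ℝ (fun z => twoFormPow (β z) k) y) := by
  have hd : DifferentiableAt ℝ β y := hβ.differentiableAt one_ne_zero
  have hP : ∀ k, DifferentiableAt ℝ (fun z => twoFormPow (β z) k) y := fun k =>
    (contDiffAt_twoFormPow hβ k).differentiableAt one_ne_zero
  have h1 : HasFDerivAt (fun z => contractL (n := 2 * k + 1) x (twoFormPow (β z) (k + 1)))
      (contractL (n := 2 * k + 1) x ∘L fderiv ℝ (fun z => twoFormPow (β z) (k + 1)) y) y :=
    (contractL (n := 2 * k + 1) x).hasFDerivAt.comp y (hP (k + 1)).hasFDerivAt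
  have h2 : HasFDerivAt (fun z => twoFormL (β z) x)
      (ContinuousLinearMap.apply ℝ _ x ∘L twoFormL ∘L fderiv ℝ β y) y :=
    (ContinuousLinearMap.apply ℝ _ x ∘L twoFormL).hasFDerivAt.comp y hd.hasFDerivAt
  have h3 := ((wedgeOneL (V := V) (2 * k)).hasFDerivAt_of_bilinear h2 (hP k).hasFDerivAt).const_smul
    (k + 1 : ℝ)
  have h4 : (fun z => contractL (n := 2 * k + 1) x (twoFormPow (β z) (k + 1))) =
      fun z => (k + 1 : ℝ) • wedgeOneL (2 * k) (twoFormL (β z) x) (twoFormPow (β z) k) := by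
    funext z
    rw [contractL_twoFormPow, wedgeOneL_apply]
  rw [h4] at h1
  rw [h1.unique h3]
  exact congrArg (fun A => (k + 1 : ℝ) • A) (add_comm _ _)

/-- The term in which one contraction hits the derivative `L` of a `2`-form `β`, and the other one
may hit a power of `β`. -/
theorem contractL_wedgeOne_twoFormPow (β : V [⋀^Fin 2]→L[ℝ] ℝ) (k : ℕ) (f : V)
    (L : V →L[ℝ] V →L[ℝ] ℝ) (v : Fin (2 * k + 1) → V) (hf : ∀ i, β ![f, v i] = 0) :
    alternatizeUncurryFin (contractL f ∘L ((wedgeOneL (2 * k)).flip (twoFormPow β k) ∘L L)) v =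
      wedgeOne (ContinuousLinearMap.apply ℝ _ f ∘L L) (twoFormPow β k) v := by
  cases k with
  | zero =>
    rw [wedgeOne]
    congr 2
    ext u w
    simp only [ContinuousLinearMap.comp_apply, ContinuousLinearMap.flip_apply, wedgeOneL_apply,
      contractL_apply, ContinuousLinearMap.smulRight_apply]
    rw [wedgeOne_apply, Fin.sum_univ_one]
    simp
  | succ k =>
    have h5 : contractL f ∘L ((wedgeOneL (2 * (k + 1))).flip (twoFormPow β (k + 1)) ∘L L) =
        (ContinuousLinearMap.apply ℝ _ f ∘L L).smulRight (twoFormPow β (k + 1)) +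
          (k + 1 : ℝ) • (wedgeOneL (2 * k + 1) (twoFormL β f) ∘L
            ((wedgeOneL (2 * k)).flip (twoFormPow β k) ∘L L)) := by
      ext u w
      simp only [ContinuousLinearMap.comp_apply, ContinuousLinearMap.flip_apply, wedgeOneL_apply,
        contractL_apply]
      rw [wedgeOne_vecCons (n := 2 * k + 1), contractL_twoFormPow, ← wedgeOneL_apply, map_smul,
        wedgeOneL_apply, wedgeOne_wedgeOne]
      simp
    have h6 : ∀ i, twoFormL β f (v i) = 0 := fun i => (twoFormL_apply _ _ _).trans (hf i)
    have h7 : ∀ η : V [⋀^Fin (2 * k + 1 + 1)]→L[ℝ] ℝ, wedgeOne (twoFormL β f) η v = 0 :=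
      fun η => wedgeOne_eq_zero h6 η
    rw [h5, alternatizeUncurryFin_add, alternatizeUncurryFin_smul, alternatizeUncurryFin_wedgeOne,
      ContinuousAlternatingMap.add_apply, ContinuousAlternatingMap.smul_apply,
      ContinuousAlternatingMap.neg_apply, h7, neg_zero, smul_zero, add_zero]
    rfl

/-- Two contractions of `d (β ^ (k + 1))`: if `e` and `f` are `β`-orthogonal to the other vectors,
and the contraction of `dβ` with `e` and `f` vanishes, then what remains is a multiple of
`d (β ^ k)`. -/
theorem extDeriv_twoFormPow_vecCons_vecCons [FiniteDimensional ℝ V]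
    {β : V → V [⋀^Fin 2]→L[ℝ] ℝ} {y : V}
    (hβ : ContDiffAt ℝ 1 β y) (k : ℕ) (e f : V)
    (hB : ∀ u, extDeriv β y ![e, f, u] = 0) (v : Fin (2 * k + 1) → V)
    (he : ∀ i, β y ![e, v i] = 0) (hf : ∀ i, β y ![f, v i] = 0) :
    extDeriv (fun z => twoFormPow (β z) (k + 1)) y (Matrix.vecCons e (Matrix.vecCons f v)) =
      (k + 1) * β y ![e, f] * extDeriv (fun z => twoFormPow (β z) k) y v := by
  have he' : ∀ η : V [⋀^Fin (2 * k)]→L[ℝ] ℝ, wedgeOne (twoFormL (β y) e) η v = 0 :=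
    fun η => wedgeOne_eq_zero (fun i => (twoFormL_apply _ _ _).trans (he i)) η
  have hf' : ∀ η : V [⋀^Fin (2 * k)]→L[ℝ] ℝ, wedgeOne (twoFormL (β y) f) η v = 0 :=
    fun η => wedgeOne_eq_zero (fun i => (twoFormL_apply _ _ _).trans (hf i)) η
  have key := contractL_comp_fderiv_twoFormPow hβ k
  have t1 : fderiv ℝ (fun z => twoFormPow (β z) (k + 1)) y e (Matrix.vecCons f v) =
      (k + 1) * wedgeOne (twoFormL (fderiv ℝ β y e) f) (twoFormPow (β y) k) v := by
    have := congrArg (fun A : V →L[ℝ] V [⋀^Fin (2 * k + 1)]→L[ℝ] ℝ => A e v) (key f)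
    refine Eq.trans this ?_
    change (k + 1 : ℝ) * (wedgeOne (twoFormL (fderiv ℝ β y e) f) (twoFormPow (β y) k) v +
      wedgeOne (twoFormL (β y) f) _ v) = _
    rw [hf', add_zero]
  have t2 : alternatizeUncurryFin (contractL (n := 2 * k + 1) e ∘L
      fderiv ℝ (fun z => twoFormPow (β z) (k + 1)) y) (Matrix.vecCons f v) =
      (k + 1) * (wedgeOne (twoFormL (fderiv ℝ β y f) e) (twoFormPow (β y) k) v -
        wedgeOne (ContinuousLinearMap.apply ℝ _ f ∘L ContinuousLinearMap.apply ℝ _ e ∘L twoFormL ∘L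
          fderiv ℝ β y) (twoFormPow (β y) k) v -
        β y ![e, f] * extDeriv (fun z => twoFormPow (β z) k) y v) := by
    rw [key, alternatizeUncurryFin_smul, alternatizeUncurryFin_add, alternatizeUncurryFin_wedgeOne,
      ContinuousAlternatingMap.smul_apply, ContinuousAlternatingMap.add_apply,
      ContinuousAlternatingMap.neg_apply, wedgeOne_vecCons, he', alternatizeUncurryFin_vecCons,
      contractL_wedgeOne_twoFormPow _ _ _ _ _ hf, sub_zero, twoFormL_apply]
    rfl
  have t3 : wedgeOne (twoFormL (fderiv ℝ β y e) f) (twoFormPow (β y) k) v -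
      wedgeOne (twoFormL (fderiv ℝ β y f) e) (twoFormPow (β y) k) v +
      wedgeOne (ContinuousLinearMap.apply ℝ _ f ∘L ContinuousLinearMap.apply ℝ _ e ∘L twoFormL ∘L
          fderiv ℝ β y) (twoFormPow (β y) k) v = 0 := by
    simp only [wedgeOne_apply]
    rw [← Finset.sum_sub_distrib, ← Finset.sum_add_distrib]
    refine Finset.sum_eq_zero fun i _ => ?_
    rw [← smul_sub, ← smul_add, ← sub_mul, ← add_mul]
    have := hB (v i)
    rw [extDeriv_two_apply] at this
    simp only [twoFormL_apply, ContinuousLinearMap.comp_apply, ContinuousLinearMap.apply_apply]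
    rw [this, zero_mul, smul_zero]
  rw [extDeriv, alternatizeUncurryFin_vecCons (n := 2 * k + 1), t2, t1]
  linear_combination (k + 1 : ℝ) * t3

/-- Suppose that a basis `(e_j, f_j)` of a space of dimension at most `2 (k + 1)` spans planes that
are pairwise `β`-orthogonal, and that all contractions of `dβ` with `e_j` and `f_j` vanish. Then
`d (β ^ k) = 0`: among any `2 k + 1` different basis vectors there are `k` complete pairs, which can
be contracted away one by one. -/
theorem extDeriv_twoFormPow_eq_zero [FiniteDimensional ℝ V] {β : V → V [⋀^Fin 2]→L[ℝ] ℝ} {y : V}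
    (hβ : ContDiffAt ℝ 1 β y) {ι : Type*} [Fintype ι] (b : Module.Basis (ι × Bool) ℝ V)
    (hB : ∀ j u, extDeriv β y ![b (j, false), b (j, true), u] = 0)
    (hb : ∀ i j s t, i ≠ j → β y ![b (i, s), b (j, t)] = 0) (k : ℕ) (hk : Fintype.card ι ≤ k + 1) :
    extDeriv (fun z => twoFormPow (β z) k) y = 0 := by
  classical
  -- `S` is the set of pairs that have not been contracted yet
  suffices H : ∀ (k : ℕ) (S : Finset ι), S.card ≤ k + 1 → ∀ v : Fin (2 * k + 1) → ι × Bool,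
      Function.Injective v → (∀ i, (v i).1 ∈ S) →
      extDeriv (fun z => twoFormPow (β z) k) y (fun i => b (v i)) = 0 by
    have h1 : (extDeriv (fun z => twoFormPow (β z) k) y).toAlternatingMap = 0 :=
      Module.Basis.ext_alternating b fun v hv => H k Finset.univ hk v hv fun _ => Finset.mem_univ _
    ext v
    exact congrArg (fun m : V [⋀^Fin (2 * k + 1)]→ₗ[ℝ] ℝ => m v) h1
  intro k
  induction k with
  | zero =>
    intro S _ v _ _
    have h1 : (fun z => twoFormPow (β z) 0) = fun _ => twoFormPow (β y) 0 := by
      funext z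
      ext v
      rw [twoFormPow_apply, twoFormPow_apply]
      simp
    rw [h1, extDeriv]
    simp [alternatizeUncurryFin_apply]
  | succ k ih =>
    intro S hS v hv hvS
    -- by counting, both vectors of some pair `j` occur
    obtain ⟨j, hj⟩ : ∃ j, (j, false) ∈ Set.range v ∧ (j, true) ∈ Set.range v := by
      by_contra hcon
      push Not at hcon
      have hinj : Function.Injective fun i => (v i).1 := by
        intro i i' h
        apply hv
        rcases hi : v i with ⟨a, _ | _⟩ <;> rcases hi' : v i' with ⟨a', _ | _⟩ <;>
          simp only [hi, hi'] at h <;> subst h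
        · rfl
        · exact (hcon a ⟨i, hi⟩ ⟨i', hi'⟩).elim
        · exact (hcon a ⟨i', hi'⟩ ⟨i, hi⟩).elim
        · rfl
      have h4 := Finset.card_le_card_of_injOn (s := Finset.univ) (t := S) (fun i => (v i).1)
        (fun i _ => hvS i) hinj.injOn
      rw [Finset.card_univ, Fintype.card_fin] at h4
      omega
    obtain ⟨⟨p, hp⟩, ⟨q, hq⟩⟩ := hj
    have hpq : p ≠ q := by
      rintro rfl
      rw [hp] at hq
      simp at hq
    -- permute the vectors so that this pair comes first
    obtain ⟨σ, hσ0, hσ1⟩ : ∃ σ : Equiv.Perm (Fin (2 * (k + 1) + 1)), σ 0 = p ∧ σ 1 = q := by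
      refine ⟨Equiv.swap (Equiv.swap 0 p 1) q * Equiv.swap 0 p, ?_, ?_⟩
      · rw [Equiv.Perm.mul_apply, Equiv.swap_apply_left, Equiv.swap_apply_of_ne_of_ne _ hpq]
        intro h
        have := (Equiv.swap (0 : Fin (2 * (k + 1) + 1)) p).injective
          ((Equiv.swap_apply_left 0 p).trans h)
        simp at this
      · rw [Equiv.Perm.mul_apply, Equiv.swap_apply_left]
    have h5 := (extDeriv (fun z => twoFormPow (β z) (k + 1)) y).toAlternatingMap.map_perm
      (fun i => b (v i)) σ
    suffices h6 : extDeriv (fun z => twoFormPow (β z) (k + 1)) y ((fun i => b (v i)) ∘ σ) = 0 by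
      have h7 := h5.symm.trans h6
      rcases Int.units_eq_one_or (Equiv.Perm.sign σ) with h8 | h8 <;> rw [h8] at h7 <;>
        simpa using h7
    let w : Fin (2 * k + 1) → ι × Bool := fun i => v (σ i.succ.succ)
    have h9 : (fun i => b (v i)) ∘ σ =
        Matrix.vecCons (b (j, false)) (Matrix.vecCons (b (j, true)) fun i => b (w i)) := by
      funext i
      refine Fin.cases ?_ (fun i => Fin.cases ?_ (fun i => ?_) i) i
      · simp [hσ0, hp]
      · simp [hσ1, hq]
      · rfl
    have hw : ∀ i, (w i).1 ≠ j := by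
      intro i h
      cases h2 : (w i).2
      · have h3 : v (σ i.succ.succ) = v (σ 0) := by
          rw [hσ0, hp]
          exact Prod.ext h h2
        exact absurd (σ.injective (hv h3)) (Fin.succ_ne_zero _)
      · have h3 : v (σ i.succ.succ) = v (σ 1) := by
          rw [hσ1, hq]
          exact Prod.ext h h2
        have h10 := σ.injective (hv h3)
        exact absurd (Fin.succ_injective _ h10) (Fin.succ_ne_zero _)
    have hjS : j ∈ S := by simpa [hp] using hvS p
    rw [h9, extDeriv_twoFormPow_vecCons_vecCons hβ k _ _ (hB j) _
      (fun i => hb _ _ _ _ (hw i).symm) (fun i => hb _ _ _ _ (hw i).symm),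
      ih (S.erase j) (by rw [Finset.card_erase_of_mem hjS]; omega) w ?_ ?_, mul_zero]
    · intro i i' h
      have := σ.injective (hv h)
      simpa using this
    · exact fun i => Finset.mem_erase.2 ⟨hw i, hvS _⟩

end ExtDerivPow

/-! ### The Nijenhuis tensor in a vector space -/

section Nijenhuis

variable {V : Type*} [NormedAddCommGroup V] [NormedSpace ℝ V]

/-- The Nijenhuis tensor of an almost complex structure `J` on a vector space, expressed through
the derivative of `J`. -/
def nijenhuis (J : V → V →L[ℝ] V) (y v w : V) : V :=
  fderiv ℝ J y (J y v) w - fderiv ℝ J y (J y w) v + J y (fderiv ℝ J y w v)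
    - J y (fderiv ℝ J y v w)

theorem fderiv_apply_field {J : V → V →L[ℝ] V} {X : V → V} {y : V} (hJ : DifferentiableAt ℝ J y)
    (hX : DifferentiableAt ℝ X y) (u : V) :
    fderiv ℝ (fun z => J z (X z)) y u = fderiv ℝ J y u (X y) + J y (fderiv ℝ X y u) := by
  rw [(hJ.hasFDerivAt.clm_apply hX.hasFDerivAt).fderiv]
  simp [add_comm]

/-- The derivatives of the fields cancel in the combination of brackets. -/
theorem lieBracket_nijenhuis {J : V → V →L[ℝ] V} {X Y : V → V} {y : V}
    (hJ : DifferentiableAt ℝ J y) (hX : DifferentiableAt ℝ X y) (hY : DifferentiableAt ℝ Y y)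
    (hsq : ∀ v, J y (J y v) = -v) :
    lieBracket ℝ (fun z => J z (X z)) (fun z => J z (Y z)) y
      - J y (lieBracket ℝ (fun z => J z (X z)) Y y) - J y (lieBracket ℝ X (fun z => J z (Y z)) y)
      - lieBracket ℝ X Y y = nijenhuis J y (X y) (Y y) := by
  simp only [lieBracket, fderiv_apply_field hJ hX, fderiv_apply_field hJ hY, map_sub, map_add, hsq,
    nijenhuis]
  abel

/-- The derivative of an almost complex structure anticommutes with it. -/
theorem fderiv_anticomm {A : V → V →L[ℝ] V} {y : V} (hA : DifferentiableAt ℝ A y)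
    (hsq : ∀ᶠ z in 𝓝 y, ∀ v, A z (A z v) = -v) (u v : V) :
    A y (fderiv ℝ A y u v) = -fderiv ℝ A y u (A y v) := by
  have h1 : (fun z => A z (A z v)) =ᶠ[𝓝 y] fun _ => -v := hsq.mono fun z hz => hz v
  have h2 := h1.fderiv_eq (𝕜 := ℝ)
  have h3 := fderiv_apply_field (X := fun z => A z v) hA (hA.clm_apply (differentiableAt_const v)) u
  rw [h2] at h3
  have h4 : fderiv ℝ (fun z => A z v) y u = fderiv ℝ A y u v := by
    simpa using fderiv_apply_field (X := fun _ => v) hA (differentiableAt_const v) u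
  rw [h4, fderiv_fun_const] at h3
  rw [eq_neg_iff_add_eq_zero, add_comm]
  exact h3.symm

/-- If `β₁` and `β₂ = β₁ (A ·, ·)` are closed and `β₁` is nondegenerate, then `A` is integrable.
The value of `β₁ (N (v, w), u)` is a combination of values of `dβ₁` and `dβ₂`. -/
theorem nijenhuis_eq_zero_of_closed {A : V → V →L[ℝ] V} {β₁ β₂ : V → V [⋀^Fin 2]→L[ℝ] ℝ} {y : V}
    (hA : DifferentiableAt ℝ A y) (h₁ : DifferentiableAt ℝ β₁ y) (h₂ : DifferentiableAt ℝ β₂ y)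
    (hsq : ∀ᶠ z in 𝓝 y, ∀ v, A z (A z v) = -v)
    (hβ : ∀ᶠ z in 𝓝 y, ∀ v w, β₂ z ![v, w] = β₁ z ![A z v, w])
    (hd₁ : ∀ u v w, extDeriv β₁ y ![u, v, w] = 0) (hd₂ : ∀ u v w, extDeriv β₂ y ![u, v, w] = 0)
    (hnd : ∀ v, (∀ w, β₁ y ![v, w] = 0) → v = 0) (v w : V) : nijenhuis A y v w = 0 := by
  have hsq0 := hsq.self_of_nhds
  have hβ0 := hβ.self_of_nhds
  have hac := fderiv_anticomm hA hsq
  simp only [extDeriv_two_apply] at hd₁ hd₂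
  have hdC : ∀ u v w, fderiv ℝ β₂ y u ![v, w] =
      fderiv ℝ β₁ y u ![A y v, w] + β₁ y ![fderiv ℝ A y u v, w] := by
    intro u v w
    have e1 : (fun z => β₂ z ![v, w]) =ᶠ[𝓝 y] fun z => twoFormL (β₁ z) (A z v) w :=
      hβ.mono fun z hz => by
        simp only [hz, twoFormL_apply]
    have e2 := e1.fderiv_eq (𝕜 := ℝ)
    have e3 : HasFDerivAt (fun z => β₂ z ![v, w])
        ((ContinuousAlternatingMap.apply ℝ V ℝ ![v, w]) ∘L fderiv ℝ β₂ y) y :=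
      (ContinuousAlternatingMap.apply ℝ V ℝ ![v, w]).hasFDerivAt.comp y h₂.hasFDerivAt
    have e4 : HasFDerivAt (fun z => twoFormL (β₁ z)) (twoFormL ∘L fderiv ℝ β₁ y) y :=
      twoFormL.hasFDerivAt.comp y h₁.hasFDerivAt
    have e5 := (e4.clm_apply (hA.hasFDerivAt.clm_apply (hasFDerivAt_const v y))).clm_apply
      (hasFDerivAt_const w y)
    rw [e3.fderiv, e5.fderiv] at e2
    have e6 := congrArg (fun L : V →L[ℝ] ℝ => L u) e2
    simp only [ContinuousLinearMap.comp_apply, _root_.add_apply, ContinuousLinearMap.flip_apply,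
      zero_add, twoFormL_apply, ContinuousLinearMap.comp_zero] at e6
    rw [add_comm]
    exact e6
  have hsw : ∀ v w, β₁ y ![v, A y w] = β₁ y ![A y v, w] := by
    intro v w
    rw [twoForm_swap, ← hβ0, twoForm_swap, neg_neg, hβ0]
  have add1 : ∀ a b c, β₁ y ![a + b, c] = β₁ y ![a, c] + β₁ y ![b, c] := by
    intro a b c
    simp only [← twoFormL_apply, map_add, _root_.add_apply]
  have sub1 : ∀ a b c, β₁ y ![a - b, c] = β₁ y ![a, c] - β₁ y ![b, c] := by
    intro a b c
    simp only [← twoFormL_apply, map_sub, _root_.sub_apply]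
  have neg1 : ∀ a c, β₁ y ![-a, c] = -β₁ y ![a, c] := by
    intro a c
    simp only [← twoFormL_apply, map_neg, _root_.neg_apply]
  have neg2 : ∀ u a c, fderiv ℝ β₁ y u ![-a, c] = -fderiv ℝ β₁ y u ![a, c] := by
    intro u a c
    simp only [← twoFormL_apply, map_neg, _root_.neg_apply]
  refine hnd _ fun u => ?_
  -- the combination `dβ₂ (Av, w, u) - dβ₂ (Aw, v, u) - dβ₁ (Av, Aw, u) + dβ₁ (v, w, u)`, in which
  -- the derivatives of `β₂` are expressed by those of `β₁` and `A`
  rw [nijenhuis, sub1, add1, sub1]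
  have a1 := hdC (A y v) w u
  have a2 := hdC (A y w) v u
  have a3 := hdC w v (A y u)
  have a4 := hdC v w (A y u)
  rw [hsw] at a3 a4
  have c1 := hd₂ (A y v) w u
  have c2 := hd₂ (A y w) v u
  have c3 := hd₁ (A y v) (A y w) u
  have c4 := hd₁ v w u
  have d1 := hdC w (A y v) u
  have d2 := hdC v (A y w) u
  have d3 := hdC u (A y v) w
  have d4 := hdC u v (A y w)
  rw [hsw] at d4
  rw [hsq0, neg2] at d1 d2 d3
  have s3 := twoForm_swap (fderiv ℝ β₂ y u) (A y w) v
  have b1 := congrArg (fun x => β₁ y ![x, u]) (hac w v)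
  have b2 := congrArg (fun x => β₁ y ![x, u]) (hac v w)
  have b3 := congrArg (fun x => β₁ y ![x, w]) (hac u v)
  simp only [neg1] at b1 b2 b3
  linarith

theorem hasFDerivAt_smul_prod {E F : Type*} [NormedAddCommGroup E] [NormedSpace ℝ E]
    [NormedAddCommGroup F] [NormedSpace ℝ F] {G : Type*} [NormedAddCommGroup G] [NormedSpace ℝ G]
    {y : E} {z : F} {f : F → ℝ} {A : E → G} (hf : DifferentiableAt ℝ f z)
    (hA : DifferentiableAt ℝ A y) :
    HasFDerivAt (fun p : E × F => f p.2 • A p.1)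
      (f z • (fderiv ℝ A y ∘L ContinuousLinearMap.fst ℝ E F) +
        (fderiv ℝ f z ∘L ContinuousLinearMap.snd ℝ E F).smulRight (A y)) (y, z) :=
  (HasFDerivAt.comp (y, z) (f := Prod.snd) hf.hasFDerivAt hasFDerivAt_snd).smul
    (HasFDerivAt.comp (y, z) (f := Prod.fst) hA.hasFDerivAt hasFDerivAt_fst)

theorem fderiv_prodMap_apply {E F : Type*} [NormedAddCommGroup E] [NormedSpace ℝ E]
    [NormedAddCommGroup F] [NormedSpace ℝ F] {I J K : E → E →L[ℝ] E} {s₀ s₁ s₂ : F → ℝ} {y : E}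
    {z : F} (j : F →L[ℝ] F) (hI : DifferentiableAt ℝ I y) (hJ : DifferentiableAt ℝ J y)
    (hK : DifferentiableAt ℝ K y) (h₀ : DifferentiableAt ℝ s₀ z) (h₁ : DifferentiableAt ℝ s₁ z)
    (h₂ : DifferentiableAt ℝ s₂ z) (v w : E × F) :
    fderiv ℝ (fun p : E × F => ContinuousLinearMap.prodMap
      (s₀ p.2 • I p.1 + s₁ p.2 • J p.1 + s₂ p.2 • K p.1) j) (y, z) v w =
      (s₀ z • fderiv ℝ I y v.1 w.1 + s₁ z • fderiv ℝ J y v.1 w.1 + s₂ z • fderiv ℝ K y v.1 w.1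
        + (fderiv ℝ s₀ z v.2 • I y w.1 + fderiv ℝ s₁ z v.2 • J y w.1 + fderiv ℝ s₂ z v.2 • K y w.1),
        0) := by
  have hD := (ContinuousLinearMap.prodMapL ℝ E E F F).hasFDerivAt.comp (y, z)
    ((((hasFDerivAt_smul_prod h₀ hI).add (hasFDerivAt_smul_prod h₁ hJ)).add
      (hasFDerivAt_smul_prod h₂ hK)).prodMk (hasFDerivAt_const j (y, z)))
  have : fderiv ℝ (fun p : E × F => ContinuousLinearMap.prodMap
    (s₀ p.2 • I p.1 + s₁ p.2 • J p.1 + s₂ p.2 • K p.1) j) (y, z) = _ := hD.fderiv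
  rw [this]
  refine Prod.ext ?_ ?_
  · change (s₀ z • fderiv ℝ I y v.1 w.1 + fderiv ℝ s₀ z v.2 • I y w.1) +
      (s₁ z • fderiv ℝ J y v.1 w.1 + fderiv ℝ s₁ z v.2 • J y w.1) +
      (s₂ z • fderiv ℝ K y v.1 w.1 + fderiv ℝ s₂ z v.2 • K y w.1) = _
    simp only
    abel
  · rfl

/-- The almost complex structure `(s₀(z) I + s₁(z) J + s₂(z) K, √-1)` on a product `E × F`, where
`s` has values in the unit sphere and satisfies the Cauchy-Riemann equation
`ds (√-1 u) = s × ds (u)`, is integrable if it is so on `E` for fixed `z`. -/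
theorem nijenhuis_prod_eq_zero {E F : Type*} [NormedAddCommGroup E] [NormedSpace ℝ E]
    [NormedAddCommGroup F] [NormedSpace ℝ F] {I J K : E → E →L[ℝ] E} {s₀ s₁ s₂ : F → ℝ} {y : E}
    {z : F} (j : F →L[ℝ] F) (hI : DifferentiableAt ℝ I y) (hJ : DifferentiableAt ℝ J y)
    (hK : DifferentiableAt ℝ K y) (h₀ : DifferentiableAt ℝ s₀ z) (h₁ : DifferentiableAt ℝ s₁ z)
    (h₂ : DifferentiableAt ℝ s₂ z)
    (hII : ∀ v, I y (I y v) = -v) (hJJ : ∀ v, J y (J y v) = -v) (hKK : ∀ v, K y (K y v) = -v)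
    (hIJ : ∀ v, I y (J y v) = K y v) (hJK : ∀ v, J y (K y v) = I y v)
    (hKI : ∀ v, K y (I y v) = J y v)
    (hs : ∀ u, s₀ z * fderiv ℝ s₀ z u + s₁ z * fderiv ℝ s₁ z u + s₂ z * fderiv ℝ s₂ z u = 0)
    (hs₀ : ∀ u, fderiv ℝ s₀ z (j u) = s₁ z * fderiv ℝ s₂ z u - s₂ z * fderiv ℝ s₁ z u)
    (hs₁ : ∀ u, fderiv ℝ s₁ z (j u) = s₂ z * fderiv ℝ s₀ z u - s₀ z * fderiv ℝ s₂ z u)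
    (hs₂ : ∀ u, fderiv ℝ s₂ z (j u) = s₀ z * fderiv ℝ s₁ z u - s₁ z * fderiv ℝ s₀ z u)
    (hN : ∀ v w, nijenhuis (fun x => s₀ z • I x + s₁ z • J x + s₂ z • K x) y v w = 0)
    (v w : E × F) :
    nijenhuis (fun p : E × F => ContinuousLinearMap.prodMap
      (s₀ p.2 • I p.1 + s₁ p.2 • J p.1 + s₂ p.2 • K p.1) j) (y, z) v w = 0 := by
  have hJI : ∀ v, J y (I y v) = -K y v := fun v => by rw [← hJK v, hJJ]
  have hKJ : ∀ v, K y (J y v) = -I y v := fun v => by rw [← hKI v, hKK]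
  have hIK : ∀ v, I y (K y v) = -J y v := fun v => by rw [← hIJ v, hII]
  have hE : HasFDerivAt (fun x => s₀ z • I x + s₁ z • J x + s₂ z • K x)
      (s₀ z • fderiv ℝ I y + s₁ z • fderiv ℝ J y + s₂ z • fderiv ℝ K y) y :=
    ((hI.hasFDerivAt.const_smul (s₀ z)).add (hJ.hasFDerivAt.const_smul (s₁ z))).add
      (hK.hasFDerivAt.const_smul (s₂ z))
  let A : E →L[ℝ] E := s₀ z • I y + s₁ z • J y + s₂ z • K y
  let L : E →L[ℝ] E →L[ℝ] E := s₀ z • fderiv ℝ I y + s₁ z • fderiv ℝ J y + s₂ z • fderiv ℝ K y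
  let S : F → E → E := fun u x =>
    fderiv ℝ s₀ z u • I y x + fderiv ℝ s₁ z u • J y x + fderiv ℝ s₂ z u • K y x
  have hN' := hN v.1 w.1
  rw [nijenhuis, hE.fderiv] at hN'
  change L (A v.1) w.1 - L (A w.1) v.1 + A (L w.1 v.1) - A (L v.1 w.1) = 0 at hN'
  -- the contributions of the derivative of `s` vanish
  have key : ∀ u x, S (j u) x = A (S u x) := by
    intro u x
    simp only [S, A, _root_.add_apply, _root_.smul_apply, map_add, map_smul, hII, hJJ, hKK, hIJ,
      hJK, hKI, hJI, hKJ, hIK, hs₀, hs₁, hs₂]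
    linear_combination (norm := module) (hs u) • x
  simp only [nijenhuis, fderiv_prodMap_apply j hI hJ hK h₀ h₁ h₂]
  refine Prod.ext ?_ ?_
  · change L (A v.1) w.1 + S (j v.2) w.1 - (L (A w.1) v.1 + S (j w.2) v.1)
      + A (L w.1 v.1 + S w.2 v.1) - A (L v.1 w.1 + S v.2 w.1) = 0
    rw [key, key, A.map_add (L w.1 v.1) (S w.2 v.1), A.map_add (L v.1 w.1) (S v.2 w.1), ← hN']
    abel
  · change (0 : F) - 0 + j 0 - j 0 = 0
    simp

theorem nijenhuis_congr {A B : V → V →L[ℝ] V} {y : V} (h : A =ᶠ[𝓝 y] B) (v w : V) :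
    nijenhuis A y v w = nijenhuis B y v w := by
  rw [nijenhuis, nijenhuis, h.fderiv_eq, h.eq_of_nhds]

end Nijenhuis

/-! ### Forms and fields of endomorphisms in charts -/

section Charts

variable {E : Type*} [NormedAddCommGroup E] [NormedSpace ℝ E]
  {H : Type*} [TopologicalSpace H] {I : ModelWithCorners ℝ E H}
  {N : Type*} [TopologicalSpace N] [ChartedSpace H N]

/-- The derivative of the inverse of the chart around `x₀`, as an endomorphism of the model space:
tangent spaces are identified with the model space by definition. -/
def chartSymmDeriv (I : ModelWithCorners ℝ E H) (x₀ : N) (y : E) : E →L[ℝ] E :=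
  mfderivWithin 𝓘(ℝ, E) I (extChartAt I x₀).symm (Set.range I) y

/-- The derivative of the chart around `x₀`, as an endomorphism of the model space. -/
def chartDeriv (I : ModelWithCorners ℝ E H) (x₀ : N) (x : N) : E →L[ℝ] E :=
  mfderiv I 𝓘(ℝ, E) (extChartAt I x₀) x

/-- The expression of a field of endomorphisms in the chart around `x₀`. -/
def EndField.inChart (J : EndField I N) (x₀ : N) (y : E) : E →L[ℝ] E :=
  chartDeriv I x₀ ((extChartAt I x₀).symm y) ∘L
    (show E →L[ℝ] E from J ((extChartAt I x₀).symm y)) ∘L chartSymmDeriv I x₀ y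

theorem DForm.inChart_apply {k : ℕ} (α : DForm I N k) (x₀ : N) (y : E) (v : Fin k → E) :
    α.inChart x₀ y v = (show E [⋀^Fin k]→L[ℝ] ℝ from α ((extChartAt I x₀).symm y))
      (fun i => chartSymmDeriv I x₀ y (v i)) := rfl

theorem DForm.inChart_two_apply (α : DForm I N 2) (x₀ : N) (y v w : E) :
    α.inChart x₀ y ![v, w] = (show E [⋀^Fin 2]→L[ℝ] ℝ from α ((extChartAt I x₀).symm y))
      ![chartSymmDeriv I x₀ y v, chartSymmDeriv I x₀ y w] := by
  rw [DForm.inChart_apply]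
  congr 1
  ext i
  fin_cases i <;> rfl

variable [IsManifold I ∞ N]

theorem chartDeriv_chartSymmDeriv {x₀ : N} {y : E} (hy : y ∈ (extChartAt I x₀).target) (v : E) :
    chartDeriv I x₀ ((extChartAt I x₀).symm y) (chartSymmDeriv I x₀ y v) = v := by
  have : IsManifold I 1 N := IsManifold.of_le (n := ∞) (by simp)
  exact congrArg (fun L : E →L[ℝ] E => L v)
    (mfderiv_extChartAt_comp_mfderivWithin_extChartAt_symm hy)

theorem chartSymmDeriv_chartDeriv {x₀ : N} {y : E} (hy : y ∈ (extChartAt I x₀).target) (v : E) :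
    chartSymmDeriv I x₀ y (chartDeriv I x₀ ((extChartAt I x₀).symm y) v) = v := by
  have : IsManifold I 1 N := IsManifold.of_le (n := ∞) (by simp)
  exact congrArg (fun L : E →L[ℝ] E => L v)
    (mfderivWithin_extChartAt_symm_comp_mfderiv_extChartAt hy)

theorem chartSymmDeriv_self (x₀ : N) :
    chartSymmDeriv I x₀ (extChartAt I x₀ x₀) = ContinuousLinearMap.id ℝ E := by
  have : IsManifold I 1 N := IsManifold.of_le (n := ∞) (by simp)
  exact mfderivWithin_range_extChartAt_symm

theorem chartDeriv_self (x₀ : N) : chartDeriv I x₀ x₀ = ContinuousLinearMap.id ℝ E := by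
  have : IsManifold I 1 N := IsManifold.of_le (n := ∞) (by simp)
  exact mfderiv_extChartAt_self

theorem DForm.inChart_self {k : ℕ} (α : DForm I N k) (x₀ : N) :
    α.inChart x₀ (extChartAt I x₀ x₀) = α x₀ := by
  have h : ∀ x : N, x = x₀ → (show E [⋀^Fin k]→L[ℝ] ℝ from α x).compContinuousLinearMap
      (chartSymmDeriv I x₀ (extChartAt I x₀ x₀)) = (show E [⋀^Fin k]→L[ℝ] ℝ from α x₀) := by
    rintro _ rfl
    rw [chartSymmDeriv_self]
    rfl
  exact h _ (extChartAt_to_inv x₀)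

theorem EndField.inChart_self (J : EndField I N) (x₀ : N) :
    J.inChart x₀ (extChartAt I x₀ x₀) = J x₀ := by
  have h : ∀ x : N, x = x₀ → chartDeriv I x₀ x ∘L (show E →L[ℝ] E from J x) ∘L
      chartSymmDeriv I x₀ (extChartAt I x₀ x₀) = (show E →L[ℝ] E from J x₀) := by
    rintro _ rfl
    rw [chartDeriv_self, chartSymmDeriv_self]
    rfl
  exact h _ (extChartAt_to_inv x₀)

theorem EndField.inChart_comp {J K L : EndField I N} (h : ∀ x v, J x (K x v) = L x v) (x₀ : N)
    {y : E} (hy : y ∈ (extChartAt I x₀).target) (v : E) :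
    J.inChart x₀ y (K.inChart x₀ y v) = L.inChart x₀ y v := by
  change chartDeriv I x₀ _ (J _ (chartSymmDeriv I x₀ y (chartDeriv I x₀ _ (K _ _)))) = _
  erw [chartSymmDeriv_chartDeriv hy]
  exact congrArg _ (h _ _)

theorem EndField.inChart_sq {J : EndField I N} (h : ∀ x v, J x (J x v) = -v) (x₀ : N)
    {y : E} (hy : y ∈ (extChartAt I x₀).target) (v : E) :
    J.inChart x₀ y (J.inChart x₀ y v) = -v := by
  rw [EndField.inChart_comp (L := fun _ => -ContinuousLinearMap.id ℝ E) h x₀ hy]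
  change chartDeriv I x₀ _ (-(chartSymmDeriv I x₀ y v)) = _
  rw [map_neg, chartDeriv_chartSymmDeriv hy]

theorem mpullbackWithin_extChartAt_symm (V : ∀ x : N, TangentSpace I x) {x₀ : N} {y : E}
    (hy : y ∈ (extChartAt I x₀).target) :
    mpullbackWithin 𝓘(ℝ, E) I (extChartAt I x₀).symm V (Set.range I) y =
      chartDeriv I x₀ ((extChartAt I x₀).symm y) (V ((extChartAt I x₀).symm y)) := by
  have : IsManifold I 1 N := IsManifold.of_le (n := ∞) (by simp)
  rw [mpullbackWithin_apply]
  rw [ContinuousLinearMap.inverse_eq (mfderivWithin_extChartAt_symm_comp_mfderiv_extChartAt hy)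
    (mfderiv_extChartAt_comp_mfderivWithin_extChartAt_symm hy)]
  rfl

variable [I.Boundaryless]

/-- Smoothness of a field of endomorphisms can be checked at the centre of each chart. -/
theorem EndField.contMDiffAt_iff (J : EndField I N) (x₀ : N) :
    ContMDiffAt I (I.prod 𝓘(ℝ, E →L[ℝ] E)) ∞
      (fun x => TotalSpace.mk' (E →L[ℝ] E)
        (E := fun x : N => TangentSpace I x →L[ℝ] TangentSpace I x) x (J x)) x₀ ↔
    ContDiffAt ℝ ∞ (J.inChart x₀) (extChartAt I x₀ x₀) := by
  have : IsManifold I 1 N := IsManifold.of_le (n := ∞) (by simp)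
  refine (contMDiffAt_hom_bundle _).trans ?_
  refine (and_iff_right (show ContMDiffAt I I ∞ (fun x => x) x₀ from contMDiffAt_id)).trans ?_
  rw [contMDiffAt_iff_source, contMDiffWithinAt_iff_contDiffWithinAt, I.range_eq_univ,
    contDiffWithinAt_univ]
  refine (fun h => ⟨fun h' => h'.congr_of_eventuallyEq h.symm,
    fun h' => h'.congr_of_eventuallyEq h⟩ : ∀ {f₁ f₂ : E → E →L[ℝ] E} {z : E}, f₁ =ᶠ[𝓝 z] f₂ →
      (ContDiffAt ℝ ∞ f₁ z ↔ ContDiffAt ℝ ∞ f₂ z)) ?_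
  filter_upwards [extChartAt_target_mem_nhds (I := I) x₀] with y hy
  have hs : (extChartAt I x₀).symm y ∈ (chartAt H x₀).source := by
    rw [← extChartAt_source I]
    exact (extChartAt I x₀).map_target hy
  simp only [Function.comp_apply, ContinuousLinearMap.inCoordinates]
  rw [TangentBundle.continuousLinearMapAt_trivializationAt hs,
    TangentBundle.symmL_trivializationAt hs]
  have h : ∀ z : E, z = y → (show E →L[ℝ] E from J ((extChartAt I x₀).symm y)) ∘L
      chartSymmDeriv I x₀ z = (show E →L[ℝ] E from J ((extChartAt I x₀).symm y)) ∘L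
      chartSymmDeriv I x₀ y := by
    rintro _ rfl
    rfl
  exact congrArg (fun L => chartDeriv I x₀ ((extChartAt I x₀).symm y) ∘L L)
    (h _ ((extChartAt I x₀).right_inv hy))

theorem mlieBracket_eq_lieBracket (V W : ∀ x : N, TangentSpace I x) (x₀ : N) :
    mlieBracket I V W x₀ = lieBracket ℝ
      (mpullbackWithin 𝓘(ℝ, E) I (extChartAt I x₀).symm V (Set.range I))
      (mpullbackWithin 𝓘(ℝ, E) I (extChartAt I x₀).symm W (Set.range I)) (extChartAt I x₀ x₀) := by
  have : IsManifold I 1 N := IsManifold.of_le (n := ∞) (by simp)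
  have h : ∀ w : E, (chartDeriv I x₀ x₀).inverse w = w := by
    rw [chartDeriv_self, ContinuousLinearMap.inverse_id]
    exact fun _ => rfl
  rw [← mlieBracketWithin_univ, mlieBracketWithin_apply]
  refine (h _).trans ?_
  rw [Set.preimage_univ, Set.univ_inter, I.range_eq_univ]
  erw [lieBracketWithin_univ]

/-- The integrability condition can be checked with the Nijenhuis tensors of the expressions in
charts, at the centres of the charts. -/
theorem isComplexStructure_of_nijenhuis [CompleteSpace E] {J : EndField I N}
    (hsmooth : ∀ x₀, ContDiffAt ℝ ∞ (J.inChart x₀) (extChartAt I x₀ x₀))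
    (hsq : ∀ x v, J x (J x v) = -v)
    (hN : ∀ x₀ v w, nijenhuis (J.inChart x₀) (extChartAt I x₀ x₀) v w = 0) :
    IsComplexStructure J where
  smooth x₀ := (J.contMDiffAt_iff x₀).2 (hsmooth x₀)
  sq := hsq
  integrable := by
    intro x V W hV hW
    have : IsManifold I 2 N := inferInstance
    have hd : ∀ V : ∀ x : N, TangentSpace I x,
        ContMDiffAt I I.tangent ∞ (fun y => (V y : TangentBundle I N)) x →
        DifferentiableAt ℝ (mpullbackWithin 𝓘(ℝ, E) I (extChartAt I x).symm V (Set.range I))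
          (extChartAt I x x) := by
      intro V hV
      have h := (hV.mdifferentiableAt (show (∞ : WithTop ℕ∞) ≠ 0 by simp)).mdifferentiableWithinAt
        (s := Set.univ) |>.differentiableWithinAt_mpullbackWithin_vectorField
      rw [Set.preimage_univ, Set.univ_inter] at h
      exact h.differentiableAt (by rw [I.range_eq_univ]; exact Filter.univ_mem)
    have hJV : ∀ V : ∀ x : N, TangentSpace I x,
        mpullbackWithin 𝓘(ℝ, E) I (extChartAt I x).symm (fun y => J y (V y)) (Set.range I)
          =ᶠ[𝓝 (extChartAt I x x)] fun y => J.inChart x y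
            (mpullbackWithin 𝓘(ℝ, E) I (extChartAt I x).symm V (Set.range I) y) := by
      intro V
      filter_upwards [extChartAt_target_mem_nhds (I := I) x] with y hy
      rw [mpullbackWithin_extChartAt_symm _ hy, mpullbackWithin_extChartAt_symm _ hy]
      change _ = chartDeriv I x _ (J _ (chartSymmDeriv I x y (chartDeriv I x _ _)))
      erw [chartSymmDeriv_chartDeriv hy]
    have a1 := (mlieBracket_eq_lieBracket (fun y => J y (V y)) (fun y => J y (W y)) x).trans
      ((hJV V).lieBracket_vectorField_eq (hJV W))
    have a2 := (mlieBracket_eq_lieBracket (fun y => J y (V y)) W x).trans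
      ((hJV V).lieBracket_vectorField_eq (Filter.EventuallyEq.refl _ _))
    have a3 := (mlieBracket_eq_lieBracket V (fun y => J y (W y)) x).trans
      (Filter.EventuallyEq.lieBracket_vectorField_eq (V := mpullbackWithin 𝓘(ℝ, E) I
        (extChartAt I x).symm V (Set.range I)) (Filter.EventuallyEq.refl _ _) (hJV W))
    rw [a1, a2, a3, mlieBracket_eq_lieBracket V W x]
    have key := lieBracket_nijenhuis ((hsmooth x).differentiableAt (by simp)) (hd V hV) (hd W hW)
      (EndField.inChart_sq hsq x (mem_extChartAt_target x))
    have key' := key.trans (hN x _ _)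
    rw [EndField.inChart_self] at key'
    exact key'

end Charts

/-! ### Charts of products and of complex manifolds -/

section ChartTransitions

variable {E : Type*} [NormedAddCommGroup E] [NormedSpace ℝ E]
  {H : Type*} [TopologicalSpace H] {I : ModelWithCorners ℝ E H}
  {N : Type*} [TopologicalSpace N] [ChartedSpace H N] [IsManifold I ∞ N] [I.Boundaryless]
  {E' : Type*} [NormedAddCommGroup E'] [NormedSpace ℝ E']
  {H' : Type*} [TopologicalSpace H'] {I' : ModelWithCorners ℝ E' H'}
  {N' : Type*} [TopologicalSpace N'] [ChartedSpace H' N'] [IsManifold I' ∞ N'] [I'.Boundaryless]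

/-- The derivative of a chart is, by definition, the derivative of a transition map: the tangent
space at a point is identified with the model space by the chart around this point. -/
theorem chartSymmDeriv_eq {x₀ : N} {y : E} (hy : y ∈ (extChartAt I x₀).target) :
    chartSymmDeriv I x₀ y = fderiv ℝ
      (extChartAt I ((extChartAt I x₀).symm y) ∘ (extChartAt I x₀).symm) y := by
  have : IsManifold I 1 N := inferInstance
  refine (mdifferentiableWithinAt_extChartAt_symm hy).mfderivWithin.trans ?_
  simp only [writtenInExtChartAt, I.range_eq_univ, Set.preimage_univ, extChartAt_model_space_eq_id,
    modelWithCornersSelf_coe, Set.range_id, Set.univ_inter, fderivWithin_univ]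
  rfl

theorem chartDeriv_eq {x₀ x : N} (hx : x ∈ (extChartAt I x₀).source) :
    chartDeriv I x₀ x = fderiv ℝ
      (extChartAt I x₀ ∘ (extChartAt I x).symm) (extChartAt I x x) := by
  have : IsManifold I 1 N := inferInstance
  rw [extChartAt_source] at hx
  refine (mdifferentiableAt_extChartAt hx).mfderiv.trans ?_
  simp only [writtenInExtChartAt, I.range_eq_univ, fderivWithin_univ]
  rfl

theorem differentiableAt_chartTransition {x₀ x : N} {y : E} (hy : y ∈ (extChartAt I x₀).target)
    (hx : (extChartAt I x₀).symm y ∈ (extChartAt I x).source) :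
    DifferentiableAt ℝ (extChartAt I x ∘ (extChartAt I x₀).symm) y := by
  have : IsManifold I 1 N := inferInstance
  have h := contDiffWithinAt_ext_coord_change (n := 1) (I := I) x x₀ (y := y)
    (by rw [PartialEquiv.trans_source]; exact ⟨hy, hx⟩)
  rw [I.range_eq_univ, contDiffWithinAt_univ] at h
  exact h.differentiableAt (by simp)

theorem chartSymmDeriv_prod {m : N} {q : N'} {y : E} {z : E'} (hy : y ∈ (extChartAt I m).target)
    (hz : z ∈ (extChartAt I' q).target) :
    chartSymmDeriv (I.prod I') (m, q) (y, z) =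
      (chartSymmDeriv I m y).prodMap (chartSymmDeriv I' q z) := by
  have hyz : (y, z) ∈ (extChartAt (I.prod I') (m, q)).target := by
    rw [extChartAt_prod]
    exact ⟨hy, hz⟩
  rw [chartSymmDeriv_eq hyz, chartSymmDeriv_eq hy, chartSymmDeriv_eq hz]
  simp only [extChartAt_prod]
  exact (HasFDerivAt.prodMap (y, z)
    (differentiableAt_chartTransition hy (mem_extChartAt_source _)).hasFDerivAt
    (differentiableAt_chartTransition hz (mem_extChartAt_source _)).hasFDerivAt).fderiv

theorem chartDeriv_prod {m x : N} {q p : N'} (hx : x ∈ (extChartAt I m).source)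
    (hp : p ∈ (extChartAt I' q).source) :
    chartDeriv (I.prod I') (m, q) (x, p) = (chartDeriv I m x).prodMap (chartDeriv I' q p) := by
  have hxp : (x, p) ∈ (extChartAt (I.prod I') (m, q)).source := by
    rw [extChartAt_prod]
    exact ⟨hx, hp⟩
  rw [chartDeriv_eq hxp, chartDeriv_eq hx, chartDeriv_eq hp]
  simp only [extChartAt_prod]
  exact (HasFDerivAt.prodMap (extChartAt I x x, extChartAt I' p p)
    (differentiableAt_chartTransition (mem_extChartAt_target _)
      (by rwa [extChartAt_to_inv])).hasFDerivAt
    (differentiableAt_chartTransition (mem_extChartAt_target _)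
      (by rwa [extChartAt_to_inv])).hasFDerivAt).fderiv

end ChartTransitions

section ComplexCharts

variable {F : Type*} [NormedAddCommGroup F] [NormedSpace ℂ F]
  {Q : Type*} [TopologicalSpace Q] [ChartedSpace F Q] [hQ : IsManifold 𝓘(ℂ, F) ω Q]

variable (F) in
/-- Multiplication by `√-1` on a complex vector space, as a real-linear map. -/
def mulI : F →L[ℝ] F :=
  ((Complex.I • ContinuousLinearMap.id ℂ F : F →L[ℂ] F)).restrictScalars ℝ

@[simp] theorem mulI_apply (v : F) : mulI F v = Complex.I • v := rfl

theorem mulI_mulI (v : F) : mulI F (mulI F v) = -v := by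
  simp [smul_smul]

/-- The transition maps are holomorphic, so their derivatives are complex linear. -/
theorem chartSymmDeriv_smul {q : Q} {z : F} (hz : z ∈ (extChartAt 𝓘(ℝ, F) q).target)
    (c : ℂ) (v : F) :
    chartSymmDeriv 𝓘(ℝ, F) q z (c • v) = c • chartSymmDeriv 𝓘(ℝ, F) q z v := by
  rw [chartSymmDeriv_eq hz]
  have h := contDiffWithinAt_ext_coord_change (n := ω) (I := 𝓘(ℂ, F))
    ((extChartAt 𝓘(ℂ, F) q).symm z) q (y := z)
    (by rw [PartialEquiv.trans_source]; exact ⟨hz, mem_extChartAt_source _⟩)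
  rw [ModelWithCorners.range_eq_univ, contDiffWithinAt_univ] at h
  have h' : DifferentiableAt ℂ (extChartAt 𝓘(ℝ, F) ((extChartAt 𝓘(ℝ, F) q).symm z) ∘
    (extChartAt 𝓘(ℝ, F) q).symm) z := h.differentiableAt (by simp)
  rw [h'.fderiv_restrictScalars ℝ]
  simp

theorem inChart_stdComplexStructure {q : Q} {z : F} (hz : z ∈ (extChartAt 𝓘(ℝ, F) q).target) :
    (stdComplexStructure F Q).inChart q z = mulI F := by
  ext v
  change chartDeriv 𝓘(ℝ, F) q _ (Complex.I • chartSymmDeriv 𝓘(ℝ, F) q z v) = _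
  rw [← chartSymmDeriv_smul hz, chartDeriv_chartSymmDeriv hz, mulI_apply]

end ComplexCharts

/-! ### The twistor data in product charts -/

section TwistorCharts

variable {E : Type*} [NormedAddCommGroup E] [NormedSpace ℝ E]
  {M : Type*} [TopologicalSpace M] [ChartedSpace E M] [IsManifold 𝓘(ℝ, E) ∞ M]
  {F : Type*} [NormedAddCommGroup F] [NormedSpace ℂ F]
  {Q : Type*} [TopologicalSpace Q] [ChartedSpace F Q]
  (S : HypercomplexStructure (E := E) M) (h : Q → CP1)

theorem twistorForm_apply (ωQ : DForm 𝓘(ℝ, F) Q 2) (t : ℝ) (m : M) (q : Q) (v w : E × F) :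
    (show (E × F) [⋀^Fin 2]→L[ℝ] ℝ from twistorForm S h ωQ t (m, q)) ![v, w] =
      (h q).toSphere 0 * S.omegaI m ![v.1, w.1] + (h q).toSphere 1 * S.omegaJ m ![v.1, w.1]
        + (h q).toSphere 2 * S.omegaK m ![v.1, w.1] + t * ωQ q ![v.2, w.2] := by
  have hf : ∀ (α : DForm 𝓘(ℝ, E) M 2), (show (E × F) [⋀^Fin 2]→L[ℝ] ℝ from
      α.pullback (I := 𝓘(ℝ, E).prod 𝓘(ℝ, F)) Prod.fst (m, q)) ![v, w] = α m ![v.1, w.1] := by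
    intro α
    simp only [DForm.pullback, mfderiv_fst]
    refine congrArg (α m) ?_
    ext i
    fin_cases i <;> rfl
  have hs : (show (E × F) [⋀^Fin 2]→L[ℝ] ℝ from
      ωQ.pullback (I := 𝓘(ℝ, E).prod 𝓘(ℝ, F)) Prod.snd (m, q)) ![v, w] = ωQ q ![v.2, w.2] := by
    simp only [DForm.pullback, mfderiv_snd]
    refine congrArg (ωQ q) ?_
    ext i
    fin_cases i <;> rfl
  rw [← hf, ← hf, ← hf, ← hs]
  rfl

variable [IsManifold 𝓘(ℂ, F) ω Q]

/-- The coordinate functions of `h`, as a map into the sphere, in the chart around `q`. -/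
def sphereInChart (h : Q → CP1) (q : Q) (k : Fin 3) (z : F) : ℝ :=
  (h ((extChartAt 𝓘(ℝ, F) q).symm z)).toSphere k

theorem inChart_twistorStructure {m : M} {q : Q} {y : E} {z : F}
    (hy : y ∈ (extChartAt 𝓘(ℝ, E) m).target) (hz : z ∈ (extChartAt 𝓘(ℝ, F) q).target) :
    (twistorStructure (F := F) S h).inChart (m, q) (y, z) = ContinuousLinearMap.prodMap
      (sphereInChart h q 0 z • S.I.inChart m y + sphereInChart h q 1 z • S.J.inChart m y
        + sphereInChart h q 2 z • S.K.inChart m y) (mulI F) := by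
  have e1 : (extChartAt (𝓘(ℝ, E).prod 𝓘(ℝ, F)) (m, q)).symm (y, z) =
      ((extChartAt 𝓘(ℝ, E) m).symm y, (extChartAt 𝓘(ℝ, F) q).symm z) := by
    rw [extChartAt_prod]
    rfl
  rw [← inChart_stdComplexStructure hz]
  rw [EndField.inChart, e1, chartSymmDeriv_prod hy hz,
    chartDeriv_prod ((extChartAt 𝓘(ℝ, E) m).map_target hy)
    ((extChartAt 𝓘(ℝ, F) q).map_target hz)]
  refine ContinuousLinearMap.ext fun v => Prod.ext ?_ rfl
  change chartDeriv 𝓘(ℝ, E) m _ (sphereInChart h q 0 z • S.I _ _ + sphereInChart h q 1 z • S.J _ _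
    + sphereInChart h q 2 z • S.K _ _) = _
  erw [map_add, map_add, map_smul, map_smul, map_smul]
  rfl

theorem inChart_twistorForm (ωQ : DForm 𝓘(ℝ, F) Q 2) (t : ℝ) {m : M} {q : Q} {y : E} {z : F}
    (hy : y ∈ (extChartAt 𝓘(ℝ, E) m).target) (hz : z ∈ (extChartAt 𝓘(ℝ, F) q).target)
    (v w : E × F) :
    (twistorForm S h ωQ t).inChart (m, q) (y, z) ![v, w] =
      sphereInChart h q 0 z * S.omegaI.inChart m y ![v.1, w.1]
        + sphereInChart h q 1 z * S.omegaJ.inChart m y ![v.1, w.1]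
        + sphereInChart h q 2 z * S.omegaK.inChart m y ![v.1, w.1]
        + t * ωQ.inChart q z ![v.2, w.2] := by
  have e1 : (extChartAt (𝓘(ℝ, E).prod 𝓘(ℝ, F)) (m, q)).symm (y, z) =
      ((extChartAt 𝓘(ℝ, E) m).symm y, (extChartAt 𝓘(ℝ, F) q).symm z) := by
    rw [extChartAt_prod]
    rfl
  simp only [DForm.inChart_two_apply]
  rw [e1, chartSymmDeriv_prod hy hz]
  exact twistorForm_apply S h ωQ t _ _ _ _

end TwistorCharts

/-! ### The projective line as the unit sphere -/

section Sphere

/-- The map from the affine coordinate of the projective line to the sphere; `ε = 1` for the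
coordinate `Z₁ / Z₂` and `ε = -1` for `Z₂ / Z₁`. -/
def stereo (ε : ℝ) (ζ : ℂ) : Fin 3 → ℝ :=
  ![ε * (1 - (ζ.re ^ 2 + ζ.im ^ 2)) / (1 + (ζ.re ^ 2 + ζ.im ^ 2)),
    2 * ζ.re / (1 + (ζ.re ^ 2 + ζ.im ^ 2)), 2 * ε * ζ.im / (1 + (ζ.re ^ 2 + ζ.im ^ 2))]

theorem toSphere_eq_stereo {i : Fin 2} {p : CP1} (hp : p ∈ CP1.affineSet i) :
    p.toSphere = stereo (if i = 1 then 1 else -1) (CP1.coord i p) := by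
  have hn : ∀ z : ℂ, ‖z‖ ^ 2 = z.re ^ 2 + z.im ^ 2 := by
    intro z
    rw [← Complex.normSq_eq_norm_sq, Complex.normSq_apply]
    ring
  conv_lhs => rw [← CP1.affinePoint_coord i hp]
  generalize CP1.coord i p = ζ
  ext k
  fin_cases i <;> fin_cases k <;>
    simp [CP1.toSphere, CP1.affinePoint, stereo, hn, Function.update] <;> ring

theorem sum_sq_toSphere (p : CP1) :
    p.toSphere 0 ^ 2 + p.toSphere 1 ^ 2 + p.toSphere 2 ^ 2 = 1 := by
  have key : ∀ (ε : ℝ) (ζ : ℂ), ε ^ 2 = 1 →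
      stereo ε ζ 0 ^ 2 + stereo ε ζ 1 ^ 2 + stereo ε ζ 2 ^ 2 = 1 := by
    intro ε ζ hε
    have hD : 1 + (ζ.re ^ 2 + ζ.im ^ 2) ≠ 0 := by positivity
    simp [stereo]
    field_simp
    linear_combination (1 - (ζ.re ^ 2 + ζ.im ^ 2)) ^ 2 * hε + 4 * ζ.im ^ 2 * hε
  rcases CP1.mem_affineSet_or p with hp | hp <;> rw [toSphere_eq_stereo hp] <;>
    exact key _ _ (by norm_num)

theorem stereo_injective {ε : ℝ} (hε : ε ^ 2 = 1) : Function.Injective (stereo ε) := by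
  intro ζ ζ' hs
  have h0 := congrFun hs 0
  have h1 := congrFun hs 1
  have h2 := congrFun hs 2
  simp only [stereo, Matrix.cons_val] at h0 h1 h2
  have hD : 0 < 1 + (ζ.re ^ 2 + ζ.im ^ 2) := by positivity
  have hD' : 0 < 1 + (ζ'.re ^ 2 + ζ'.im ^ 2) := by positivity
  have hε0 : ε ≠ 0 := by
    rintro rfl
    norm_num at hε
  -- the first coordinate determines the absolute value of the affine coordinate
  have hDD : ζ.re ^ 2 + ζ.im ^ 2 = ζ'.re ^ 2 + ζ'.im ^ 2 := by
    rw [div_eq_div_iff hD.ne' hD'.ne'] at h0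
    have h0' := mul_left_cancel₀ hε0 (show ε * ((1 - (ζ.re ^ 2 + ζ.im ^ 2)) *
      (1 + (ζ'.re ^ 2 + ζ'.im ^ 2))) = ε * ((1 - (ζ'.re ^ 2 + ζ'.im ^ 2)) *
      (1 + (ζ.re ^ 2 + ζ.im ^ 2))) by linarith)
    linarith
  rw [hDD] at h1 h2
  rw [div_left_inj' hD'.ne'] at h1 h2
  refine Complex.ext (by linarith) ?_
  exact mul_left_cancel₀ (mul_ne_zero two_ne_zero hε0) h2

theorem toSphere_injective : Function.Injective CP1.toSphere := by
  have inj : ∀ (i : Fin 2) (p p' : CP1), p ∈ CP1.affineSet i → p' ∈ CP1.affineSet i →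
      p.toSphere = p'.toSphere → p = p' := by
    intro i p p' hp hp' hs
    rw [toSphere_eq_stereo hp, toSphere_eq_stereo hp'] at hs
    rw [← CP1.affinePoint_coord i hp, ← CP1.affinePoint_coord i hp',
      stereo_injective (by split_ifs <;> norm_num) hs]
  -- the point `[1, 0]` is the only one mapped to the south pole
  have south : ∀ p p' : CP1, p ∉ CP1.affineSet 1 → p' ∈ CP1.affineSet 1 →
      p.toSphere ≠ p'.toSphere := by
    intro p p' hp hp' hs
    have hc : CP1.coord 0 p = 0 := by
      induction p using Projectivization.ind with
      | h v hv =>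
        have hv1 : v 1 = 0 := not_not.1 hp
        simp [CP1.coord, hv1]
    rw [toSphere_eq_stereo ((CP1.mem_affineSet_or p).resolve_right hp),
      toSphere_eq_stereo hp', hc] at hs
    have h0 := congrFun hs 0
    have hD : 0 < 1 + ((CP1.coord 1 p').re ^ 2 + (CP1.coord 1 p').im ^ 2) := by positivity
    simp [stereo] at h0
    rw [eq_div_iff hD.ne'] at h0
    linarith
  intro p p' hs
  by_cases hp : p ∈ CP1.affineSet 1 <;> by_cases hp' : p' ∈ CP1.affineSet 1
  · exact inj 1 p p' hp hp' hs
  · exact (south p' p hp' hp hs.symm).elim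
  · exact (south p p' hp hp' hs).elim
  · exact inj 0 p p' ((CP1.mem_affineSet_or p).resolve_right hp)
      ((CP1.mem_affineSet_or p').resolve_right hp') hs

theorem contDiff_stereo (ε : ℝ) (k : Fin 3) : ContDiff ℝ ∞ (fun ζ => stereo ε ζ k) := by
  have hre : ContDiff ℝ ∞ (fun ζ : ℂ => ζ.re) := Complex.reCLM.contDiff
  have him : ContDiff ℝ ∞ (fun ζ : ℂ => ζ.im) := Complex.imCLM.contDiff
  have hD : ∀ ζ : ℂ, 1 + (ζ.re ^ 2 + ζ.im ^ 2) ≠ 0 := fun ζ => by positivity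
  fin_cases k
  · exact ContDiff.div (by fun_prop) (by fun_prop) hD
  · exact ContDiff.div (by fun_prop) (by fun_prop) hD
  · exact ContDiff.div (by fun_prop) (by fun_prop) hD

theorem fderiv_stereo_apply (ε : ℝ) (ζ w : ℂ) (k : Fin 3) :
    fderiv ℝ (fun ζ => stereo ε ζ k) ζ w =
      ![-4 * ε * (ζ.re * w.re + ζ.im * w.im) / (1 + (ζ.re ^ 2 + ζ.im ^ 2)) ^ 2,
        2 * w.re / (1 + (ζ.re ^ 2 + ζ.im ^ 2)) - 4 * ζ.re * (ζ.re * w.re + ζ.im * w.im) /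
          (1 + (ζ.re ^ 2 + ζ.im ^ 2)) ^ 2,
        2 * ε * w.im / (1 + (ζ.re ^ 2 + ζ.im ^ 2)) - 4 * ε * ζ.im * (ζ.re * w.re + ζ.im * w.im) /
          (1 + (ζ.re ^ 2 + ζ.im ^ 2)) ^ 2] k := by
  have hd := ((contDiff_stereo ε k).differentiable (by simp) ζ).hasFDerivAt.hasLineDerivAt w
  have hD : ∀ ζ : ℂ, 1 + (ζ.re ^ 2 + ζ.im ^ 2) ≠ 0 := fun ζ => by positivity
  have hx : HasDerivAt (fun t : ℝ => (ζ + t • w).re) w.re 0 := by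
    simpa using ((hasDerivAt_id (0 : ℝ)).mul_const w.re).const_add ζ.re
  have hy : HasDerivAt (fun t : ℝ => (ζ + t • w).im) w.im 0 := by
    simpa using ((hasDerivAt_id (0 : ℝ)).mul_const w.im).const_add ζ.im
  have h2 := ((hx.pow 2).add (hy.pow 2))
  have hne := hD ζ
  refine hd.unique ?_
  fin_cases k
  · refine (((h2.const_sub 1).const_mul ε).div (h2.const_add 1) (hD _)).congr_deriv ?_
    simp
    field_simp
    ring
  · refine ((hx.const_mul 2).div (h2.const_add 1) (hD _)).congr_deriv ?_
    simp
    field_simp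
    ring
  · refine ((hy.const_mul (2 * ε)).div (h2.const_add 1) (hD _)).congr_deriv ?_
    simp
    field_simp
    ring

/-- The Cauchy–Riemann equations of the identification of the projective line with the sphere:
multiplication by `√-1` becomes the vector product with the position vector. -/
theorem fderiv_stereo_I_mul {ε : ℝ} (hε : ε ^ 2 = 1) (ζ w : ℂ) (k : Fin 3) :
    fderiv ℝ (fun ζ => stereo ε ζ k) ζ (Complex.I * w) =
      stereo ε ζ (k + 1) * fderiv ℝ (fun ζ => stereo ε ζ (k + 2)) ζ w
        - stereo ε ζ (k + 2) * fderiv ℝ (fun ζ => stereo ε ζ (k + 1)) ζ w := by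
  have hD : 1 + (ζ.re ^ 2 + ζ.im ^ 2) ≠ 0 := by positivity
  simp only [fderiv_stereo_apply]
  have hc : ε = 1 ∨ ε = -1 := mul_self_eq_one_iff.1 (by rw [← sq, hε])
  rcases hc with rfl | rfl <;> fin_cases k <;> simp [stereo] <;> field_simp <;> ring

end Sphere

section SphereInChart

variable {F : Type*} [NormedAddCommGroup F] [NormedSpace ℂ F]
  {Q : Type*} [TopologicalSpace Q] [ChartedSpace F Q]
  {h : Q → CP1}

theorem sphereInChart_eventuallyEq (hh : Continuous h) {q : Q} {z : F} (hz : z ∈ (extChartAt 𝓘(ℝ, F) q).target)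
    {i : Fin 2} (hi : h ((extChartAt 𝓘(ℝ, F) q).symm z) ∈ CP1.affineSet i) (k : Fin 3) :
    sphereInChart h q k =ᶠ[𝓝 z] fun y => stereo (if i = 1 then 1 else -1)
      (CP1.coord i (h ((extChartAt 𝓘(ℝ, F) q).symm y))) k := by
  have hc : ContinuousAt (fun y => h ((extChartAt 𝓘(ℝ, F) q).symm y)) z :=
    hh.continuousAt.comp (continuousAt_extChartAt_symm'' hz)
  filter_upwards [hc.preimage_mem_nhds ((CP1.isOpen_affineSet i).mem_nhds hi)] with y hy
  exact congrFun (toSphere_eq_stereo hy) k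

variable [IsManifold 𝓘(ℂ, F) ω Q]

theorem contDiffAt_coord_inChart (hh : ContMDiff 𝓘(ℂ, F) 𝓘(ℂ, ℂ) ω h) {q : Q} {z : F} (hz : z ∈ (extChartAt 𝓘(ℝ, F) q).target)
    {i : Fin 2} (hi : h ((extChartAt 𝓘(ℝ, F) q).symm z) ∈ CP1.affineSet i) :
    ContDiffAt ℂ ω (fun y => CP1.coord i (h ((extChartAt 𝓘(ℝ, F) q).symm y))) z := by
  have h1 : ContMDiffAt 𝓘(ℂ, ℂ) 𝓘(ℂ, ℂ) ω (CP1.affineChart i)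
      (h ((extChartAt 𝓘(ℝ, F) q).symm z)) :=
    (contMDiffOn_of_mem_maximalAtlas (IsManifold.subset_maximalAtlas
      (show CP1.affineChart i ∈ atlas ℂ CP1 from ⟨i, rfl⟩))).contMDiffAt
      ((CP1.isOpen_affineSet i).mem_nhds hi)
  have h2 : ContMDiffAt 𝓘(ℂ, F) 𝓘(ℂ, F) ω (extChartAt 𝓘(ℂ, F) q).symm z :=
    (contMDiffOn_extChartAt_symm q).contMDiffAt (extChartAt_target_mem_nhds' hz)
  exact ((h1.comp _ (hh _)).comp z h2).contDiffAt

theorem contDiffAt_sphereInChart (hh : ContMDiff 𝓘(ℂ, F) 𝓘(ℂ, ℂ) ω h) {q : Q} {z : F} (hz : z ∈ (extChartAt 𝓘(ℝ, F) q).target)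
    (k : Fin 3) : ContDiffAt ℝ ∞ (sphereInChart h q k) z := by
  have key : ∀ i, h ((extChartAt 𝓘(ℝ, F) q).symm z) ∈ CP1.affineSet i →
      ContDiffAt ℝ ∞ (sphereInChart h q k) z := by
    intro i hi
    refine ContDiffAt.congr_of_eventuallyEq ?_ (sphereInChart_eventuallyEq hh.continuous hz hi k)
    exact (contDiff_stereo _ k).contDiffAt.comp z
      (((contDiffAt_coord_inChart hh hz hi).restrict_scalars ℝ).of_le le_top)
  exact (CP1.mem_affineSet_or _).elim (key 0) (key 1)

theorem fderiv_sphereInChart_mulI (hh : ContMDiff 𝓘(ℂ, F) 𝓘(ℂ, ℂ) ω h) {q : Q} {z : F} (hz : z ∈ (extChartAt 𝓘(ℝ, F) q).target)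
    (k : Fin 3) (u : F) :
    fderiv ℝ (sphereInChart h q k) z (mulI F u) =
      sphereInChart h q (k + 1) z * fderiv ℝ (sphereInChart h q (k + 2)) z u
        - sphereInChart h q (k + 2) z * fderiv ℝ (sphereInChart h q (k + 1)) z u := by
  have key : ∀ i, h ((extChartAt 𝓘(ℝ, F) q).symm z) ∈ CP1.affineSet i →
      fderiv ℝ (sphereInChart h q k) z (mulI F u) =
      sphereInChart h q (k + 1) z * fderiv ℝ (sphereInChart h q (k + 2)) z u
        - sphereInChart h q (k + 2) z * fderiv ℝ (sphereInChart h q (k + 1)) z u := by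
    intro i hi
    have hd := (contDiffAt_coord_inChart hh hz hi).differentiableAt (by simp)
    have hk : ∀ (k : Fin 3) (u : F), fderiv ℝ (sphereInChart h q k) z u =
        fderiv ℝ (fun ζ => stereo (if i = 1 then 1 else -1) ζ k)
          (CP1.coord i (h ((extChartAt 𝓘(ℝ, F) q).symm z)))
          (fderiv ℂ (fun y => CP1.coord i (h ((extChartAt 𝓘(ℝ, F) q).symm y))) z u) := by
      intro k u
      rw [(sphereInChart_eventuallyEq hh.continuous hz hi k).fderiv_eq]
      have hc := ((contDiff_stereo (if i = 1 then 1 else -1) k).differentiable (by simp)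
        (CP1.coord i (h ((extChartAt 𝓘(ℝ, F) q).symm z)))).hasFDerivAt.comp z
          (hd.hasFDerivAt.restrictScalars ℝ)
      exact congrArg (fun L : F →L[ℝ] ℝ => L u) hc.fderiv
    rw [hk, hk, hk, (sphereInChart_eventuallyEq hh.continuous hz hi (k + 1)).eq_of_nhds,
      (sphereInChart_eventuallyEq hh.continuous hz hi (k + 2)).eq_of_nhds, mulI_apply, map_smul, smul_eq_mul]
    exact fderiv_stereo_I_mul (by split_ifs <;> norm_num) _ _ _
  exact (CP1.mem_affineSet_or _).elim (key 0) (key 1)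

theorem sum_sphereInChart_mul_fderiv (hh : ContMDiff 𝓘(ℂ, F) 𝓘(ℂ, ℂ) ω h) {q : Q} {z : F} (hz : z ∈ (extChartAt 𝓘(ℝ, F) q).target)
    (u : F) :
    sphereInChart h q 0 z * fderiv ℝ (sphereInChart h q 0) z u
      + sphereInChart h q 1 z * fderiv ℝ (sphereInChart h q 1) z u
      + sphereInChart h q 2 z * fderiv ℝ (sphereInChart h q 2) z u = 0 := by
  have hd : ∀ k, HasFDerivAt (sphereInChart h q k) (fderiv ℝ (sphereInChart h q k) z) z :=
    fun k => ((contDiffAt_sphereInChart hh hz k).differentiableAt (by simp)).hasFDerivAt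
  have h1 := (((hd 0).mul (hd 0)).add ((hd 1).mul (hd 1))).add ((hd 2).mul (hd 2))
  have h2 : HasFDerivAt (sphereInChart h q 0 * sphereInChart h q 0
      + sphereInChart h q 1 * sphereInChart h q 1 + sphereInChart h q 2 * sphereInChart h q 2)
      (0 : F →L[ℝ] ℝ) z := by
    refine (hasFDerivAt_const (1 : ℝ) z).congr_of_eventuallyEq (Filter.Eventually.of_forall ?_)
    intro y
    have := sum_sq_toSphere (h ((extChartAt 𝓘(ℝ, F) q).symm y))
    simp only [Pi.add_apply, Pi.mul_apply, sphereInChart]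
    linarith
  have h3 := congrArg (fun L : F →L[ℝ] ℝ => L u) (h1.unique h2)
  simp at h3
  linarith

end SphereInChart

/-! ### Closed forms in charts -/

section ClosedForms

variable {E : Type*} [NormedAddCommGroup E] [NormedSpace ℝ E]
  {H : Type*} [TopologicalSpace H] {I : ModelWithCorners ℝ E H}
  {N : Type*} [TopologicalSpace N] [ChartedSpace H N]

theorem EndField.chartSymmDeriv_inChart [IsManifold I ∞ N] (J : EndField I N) {x₀ : N} {y : E}
    (hy : y ∈ (extChartAt I x₀).target) (v : E) :
    chartSymmDeriv I x₀ y (J.inChart x₀ y v) =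
      J ((extChartAt I x₀).symm y) (chartSymmDeriv I x₀ y v) :=
  chartSymmDeriv_chartDeriv hy _

variable [I.Boundaryless]

theorem DForm.IsSmooth.contDiffAt {k : ℕ} {α : DForm I N k} (hα : α.IsSmooth) {x₀ : N} {y : E}
    (hy : y ∈ (extChartAt I x₀).target) : ContDiffAt ℝ ∞ (α.inChart x₀) y :=
  (hα x₀).contDiffAt ((isOpen_extChartAt_target x₀).mem_nhds hy)

theorem DForm.d_eq_zero_iff [IsManifold I ∞ N] {k : ℕ} (α : DForm I N k) :
    α.d = 0 ↔ ∀ x : N, extDeriv (α.inChart x) (extChartAt I x x) = 0 := by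
  have key : ∀ x : N, (show E [⋀^Fin (k + 1)]→L[ℝ] ℝ from α.d x) =
      extDeriv (α.inChart x) (extChartAt I x x) := by
    intro x
    change (extDerivWithin _ _ _).compContinuousLinearMap (chartDeriv I x x) = _
    rw [I.range_eq_univ, extDerivWithin_univ, chartDeriv_self]
    rfl
  rw [funext_iff]
  exact forall_congr' fun x => by rw [← key x]; rfl

end ClosedForms

/-! ### Hypercomplex structures in charts -/

section Hypercomplex

variable {E : Type*} [NormedAddCommGroup E] [NormedSpace ℝ E]
  {M : Type*} [TopologicalSpace M] [ChartedSpace E M] [IsManifold 𝓘(ℝ, E) ∞ M]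
  (S : HypercomplexStructure (E := E) M)

namespace HypercomplexStructure

/-- The metric in the chart around `m`. -/
def metricInChart (m : M) (y : E) (v w : E) : ℝ :=
  S.g.inner ((extChartAt 𝓘(ℝ, E) m).symm y) (chartSymmDeriv 𝓘(ℝ, E) m y v)
    (chartSymmDeriv 𝓘(ℝ, E) m y w)

variable {m : M} {y : E}

theorem metricInChart_add_left (u v w : E) : S.metricInChart m y (u + v) w =
    S.metricInChart m y u w + S.metricInChart m y v w := by
  simp only [metricInChart, map_add]
  erw [map_add, _root_.add_apply]

theorem metricInChart_smul_left (c : ℝ) (v w : E) : S.metricInChart m y (c • v) w =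
    c * S.metricInChart m y v w := by
  simp only [metricInChart, map_smul]
  erw [map_smul, _root_.smul_apply]
  rfl

theorem metricInChart_symm (v w : E) : S.metricInChart m y v w = S.metricInChart m y w v :=
  S.g.symm _ _ _

theorem metricInChart_pos (hy : y ∈ (extChartAt 𝓘(ℝ, E) m).target) {v : E} (hv : v ≠ 0) :
    0 < S.metricInChart m y v v := by
  refine S.g.pos _ _ fun h0 => hv ?_
  rw [← chartDeriv_chartSymmDeriv hy v]
  exact (congrArg _ h0).trans (map_zero _)

theorem inChart_twoFormOf {A : EndField 𝓘(ℝ, E) M} (hA hg)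
    (hy : y ∈ (extChartAt 𝓘(ℝ, E) m).target) (v w : E) :
    (S.twoFormOf A hA hg).inChart m y ![v, w] =
      S.metricInChart m y (A.inChart m y v) w := by
  rw [DForm.inChart_two_apply, metricInChart, EndField.chartSymmDeriv_inChart A hy]
  rfl

/-- The combination `a ω_I + b ω_J + c ω_K` in the chart around `m`, for constants `a`, `b`, `c`. -/
def formInChart (m : M) (a b c : ℝ) : E → E [⋀^Fin 2]→L[ℝ] ℝ :=
  a • S.omegaI.inChart m + b • S.omegaJ.inChart m + c • S.omegaK.inChart m

/-- The combination `a I + b J + c K` in the chart around `m`, for constants `a`, `b`, `c`. -/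
def endInChart (m : M) (a b c : ℝ) : E → E →L[ℝ] E :=
  a • S.I.inChart m + b • S.J.inChart m + c • S.K.inChart m

theorem endInChart_apply (a b c : ℝ) (v : E) : S.endInChart m a b c y v =
    a • S.I.inChart m y v + b • S.J.inChart m y v + c • S.K.inChart m y v := rfl

theorem formInChart_apply (hy : y ∈ (extChartAt 𝓘(ℝ, E) m).target) (a b c : ℝ) (v w : E) :
    S.formInChart m a b c y ![v, w] = S.metricInChart m y (S.endInChart m a b c y v) w := by
  rw [endInChart_apply, metricInChart_add_left, metricInChart_add_left, metricInChart_smul_left,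
    metricInChart_smul_left, metricInChart_smul_left, ← inChart_twoFormOf S _ _ hy,
    ← inChart_twoFormOf S _ _ hy, ← inChart_twoFormOf S _ _ hy]
  rfl

/-- The multiplication of quaternions without real part. -/
theorem endInChart_endInChart (hy : y ∈ (extChartAt 𝓘(ℝ, E) m).target) (a b c a' b' c' : ℝ)
    (v : E) : S.endInChart m a b c y (S.endInChart m a' b' c' y v) =
      -(a * a' + b * b' + c * c') • v +
        S.endInChart m (b * c' - c * b') (c * a' - a * c') (a * b' - b * a') y v := by
  have hII := EndField.inChart_sq S.isComplexStructure_I.sq m hy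
  have hJJ := EndField.inChart_sq S.isComplexStructure_J.sq m hy
  have hKK := EndField.inChart_sq S.isComplexStructure_K.sq m hy
  have hIJ := EndField.inChart_comp S.I_J m hy
  have hJK := EndField.inChart_comp S.J_K m hy
  have hKI := EndField.inChart_comp S.K_I m hy
  have hJI : ∀ v, S.J.inChart m y (S.I.inChart m y v) = -S.K.inChart m y v := fun v => by
    rw [← hJK v, hJJ]
  have hKJ : ∀ v, S.K.inChart m y (S.J.inChart m y v) = -S.I.inChart m y v := fun v => by
    rw [← hKI v, hKK]
  have hIK : ∀ v, S.I.inChart m y (S.K.inChart m y v) = -S.J.inChart m y v := fun v => by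
    rw [← hIJ v, hII]
  simp only [endInChart_apply, map_add, map_smul, hII, hJJ, hKK, hIJ, hJK, hKI, hJI, hKJ, hIK]
  module

theorem contDiffAt_endInChart (a b c : ℝ) :
    ContDiffAt ℝ ∞ (S.endInChart m a b c) (extChartAt 𝓘(ℝ, E) m m) := by
  have hI := (S.I.contMDiffAt_iff m).1 (S.isComplexStructure_I.smooth m)
  have hJ := (S.J.contMDiffAt_iff m).1 (S.isComplexStructure_J.smooth m)
  have hK := (S.K.contMDiffAt_iff m).1 (S.isComplexStructure_K.smooth m)
  exact ((hI.const_smul a).add (hJ.const_smul b)).add (hK.const_smul c)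

variable {S}

theorem IsHyperKahler.contDiffAt_formInChart (hS : S.IsHyperKahler)
    (hy : y ∈ (extChartAt 𝓘(ℝ, E) m).target) (a b c : ℝ) :
    ContDiffAt ℝ ∞ (S.formInChart m a b c) y :=
  (((hS.isKahlerForm_I.smooth.contDiffAt hy).const_smul a).add
    ((hS.isKahlerForm_J.smooth.contDiffAt hy).const_smul b)).add
    ((hS.isKahlerForm_K.smooth.contDiffAt hy).const_smul c)

theorem IsHyperKahler.extDeriv_formInChart (hS : S.IsHyperKahler) (a b c : ℝ) :
    extDeriv (S.formInChart m a b c) (extChartAt 𝓘(ℝ, E) m m) = 0 := by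
  have hy := mem_extChartAt_target (I := 𝓘(ℝ, E)) m
  have hI := (hS.isKahlerForm_I.smooth.contDiffAt hy).differentiableAt (by simp)
  have hJ := (hS.isKahlerForm_J.smooth.contDiffAt hy).differentiableAt (by simp)
  have hK := (hS.isKahlerForm_K.smooth.contDiffAt hy).differentiableAt (by simp)
  unfold formInChart
  rw [extDeriv_add ((hI.const_smul a).add (hJ.const_smul b)) (hK.const_smul c),
    extDeriv_add (hI.const_smul a) (hJ.const_smul b), extDeriv_smul, extDeriv_smul,
    extDeriv_smul, (DForm.d_eq_zero_iff _).1 hS.isKahlerForm_I.closed,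
    (DForm.d_eq_zero_iff _).1 hS.isKahlerForm_J.closed,
    (DForm.d_eq_zero_iff _).1 hS.isKahlerForm_K.closed]
  simp

/-- The forms `a ω_I + b ω_J + c ω_K` are non-degenerate. -/
theorem formInChart_nondegenerate (hy : y ∈ (extChartAt 𝓘(ℝ, E) m).target) {a b c : ℝ} {v : E}
    (hv : ∀ w, S.formInChart m a b c y ![v, w] = 0) (hv0 : v ≠ 0) :
    a * a + b * b + c * c = 0 := by
  have h0 : S.endInChart m a b c y v = 0 := by
    by_contra hne
    have := hv (S.endInChart m a b c y v)
    rw [formInChart_apply S hy] at this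
    exact (S.metricInChart_pos hy hne).ne' this
  have h2 := endInChart_endInChart S hy a b c a b c v
  rw [h0, map_zero, endInChart_apply] at h2
  have h3 : (a * a + b * b + c * c) • v = 0 := by
    rw [← sub_eq_zero.2 h2]
    module
  exact (smul_eq_zero.1 h3).resolve_right hv0

/-- Each complex structure `a I + b J + c K` with `a² + b² + c² = 1` is integrable: for a unit
vector `β` orthogonal to `(a, b, c)`, the forms `ω_β` and `ω_β (A ·, ·)` are closed. -/
theorem IsHyperKahler.nijenhuis_endInChart (hS : S.IsHyperKahler) {a b c : ℝ}
    (h1 : a ^ 2 + b ^ 2 + c ^ 2 = 1) (v w : E) :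
    nijenhuis (S.endInChart m a b c) (extChartAt 𝓘(ℝ, E) m m) v w = 0 := by
  obtain ⟨p, q, r, ho, hu⟩ : ∃ p q r : ℝ, p * a + q * b + r * c = 0 ∧
      p * p + q * q + r * r ≠ 0 := by
    by_cases hc : a * a + b * b = 0
    · have ha : a = 0 := by nlinarith [mul_self_nonneg a, mul_self_nonneg b]
      exact ⟨1, 0, 0, by simp [ha], by norm_num⟩
    · exact ⟨-b, a, 0, by ring, fun h => hc (by linarith)⟩
  have hy := mem_extChartAt_target (I := 𝓘(ℝ, E)) m
  refine nijenhuis_eq_zero_of_closed (β₁ := S.formInChart m p q r)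
    (β₂ := S.formInChart m (q * c - r * b) (r * a - p * c) (p * b - q * a))
    ((S.contDiffAt_endInChart a b c).differentiableAt (by simp))
    ((hS.contDiffAt_formInChart hy _ _ _).differentiableAt (by simp))
    ((hS.contDiffAt_formInChart hy _ _ _).differentiableAt (by simp)) ?_ ?_ ?_ ?_ ?_ v w
  · filter_upwards [extChartAt_target_mem_nhds (I := 𝓘(ℝ, E)) m] with z hz v
    rw [endInChart_endInChart S hz, endInChart_apply]
    have : a * a + b * b + c * c = 1 := by linarith
    rw [this]
    module
  · filter_upwards [extChartAt_target_mem_nhds (I := 𝓘(ℝ, E)) m] with z hz v w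
    rw [formInChart_apply S hz, formInChart_apply S hz, endInChart_endInChart S hz, ho]
    simp
  · intro u v w
    rw [hS.extDeriv_formInChart]
    rfl
  · intro u v w
    rw [hS.extDeriv_formInChart]
    rfl
  · intro v hv
    by_contra hne
    exact hu (formInChart_nondegenerate hy hv hne)

end HypercomplexStructure
end Hypercomplex

/-! ### The twistor structure is integrable and its form is positive -/

section TwistorStructure

namespace HypercomplexStructure

variable {E : Type*} [NormedAddCommGroup E] [NormedSpace ℝ E]
  {M : Type*} [TopologicalSpace M] [ChartedSpace E M] [IsManifold 𝓘(ℝ, E) ∞ M]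
  (S : HypercomplexStructure (E := E) M) {m : M} {y : E}

/-- The endomorphisms `a I + b J + c K` are skew-symmetric. -/
theorem metricInChart_endInChart_left (hy : y ∈ (extChartAt 𝓘(ℝ, E) m).target) (a b c : ℝ)
    (v w : E) : S.metricInChart m y (S.endInChart m a b c y v) w =
      -S.metricInChart m y (S.endInChart m a b c y w) v := by
  rw [← formInChart_apply S hy, ← formInChart_apply S hy, twoForm_swap]

theorem metricInChart_endInChart_endInChart (hy : y ∈ (extChartAt 𝓘(ℝ, E) m).target) {a b c : ℝ}
    (h1 : a ^ 2 + b ^ 2 + c ^ 2 = 1) (v w : E) :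
    S.metricInChart m y (S.endInChart m a b c y v) (S.endInChart m a b c y w) =
      S.metricInChart m y v w := by
  rw [metricInChart_endInChart_left S hy, endInChart_endInChart S hy,
    show a * a + b * b + c * c = 1 by linarith, metricInChart_symm S v w]
  rw [show -(1 : ℝ) • w + S.endInChart m (b * c - c * b) (c * a - a * c) (a * b - b * a) y w
      = (-1 : ℝ) • w by rw [endInChart_apply]; module, metricInChart_smul_left]
  ring

end HypercomplexStructure

variable {E : Type*} [NormedAddCommGroup E] [NormedSpace ℝ E]
  {M : Type*} [TopologicalSpace M] [ChartedSpace E M] [IsManifold 𝓘(ℝ, E) ∞ M]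
  {F : Type*} [NormedAddCommGroup F] [NormedSpace ℂ F]
  {Q : Type*} [TopologicalSpace Q] [ChartedSpace F Q]
  {S : HypercomplexStructure (E := E) M} {h : Q → CP1}

theorem twistorStructure_apply (m : M) (q : Q) (v : E × F) :
    (show E × F →L[ℝ] E × F from twistorStructure (F := F) S h (m, q)) v =
      (S.endInChart m ((h q).toSphere 0) ((h q).toSphere 1) ((h q).toSphere 2)
        (extChartAt 𝓘(ℝ, E) m m) v.1, mulI F v.2) := by
  rw [HypercomplexStructure.endInChart_apply, EndField.inChart_self, EndField.inChart_self,
    EndField.inChart_self]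
  rfl

theorem twistorForm_apply_eq_metricInChart (ωQ : DForm 𝓘(ℝ, F) Q 2) (t : ℝ) (m : M) (q : Q)
    (v w : E × F) :
    (show (E × F) [⋀^Fin 2]→L[ℝ] ℝ from twistorForm S h ωQ t (m, q)) ![v, w] =
      S.metricInChart m (extChartAt 𝓘(ℝ, E) m m)
        (S.endInChart m ((h q).toSphere 0) ((h q).toSphere 1) ((h q).toSphere 2)
          (extChartAt 𝓘(ℝ, E) m m) v.1) w.1 + t * ωQ q ![v.2, w.2] := by
  rw [twistorForm_apply, ← HypercomplexStructure.formInChart_apply S (mem_extChartAt_target m)]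
  simp only [← DForm.inChart_self S.omegaI, ← DForm.inChart_self S.omegaJ,
    ← DForm.inChart_self S.omegaK]
  rfl

variable [IsManifold 𝓘(ℂ, F) ω Q]

theorem inChart_twistorStructure_eventuallyEq (m : M) (q : Q) :
    (twistorStructure (F := F) S h).inChart (m, q)
      =ᶠ[𝓝 (extChartAt 𝓘(ℝ, E) m m, extChartAt 𝓘(ℝ, F) q q)]
      fun p => ContinuousLinearMap.prodMap (sphereInChart h q 0 p.2 • S.I.inChart m p.1
        + sphereInChart h q 1 p.2 • S.J.inChart m p.1
        + sphereInChart h q 2 p.2 • S.K.inChart m p.1) (mulI F) := by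
  filter_upwards [prod_mem_nhds (extChartAt_target_mem_nhds (I := 𝓘(ℝ, E)) m)
    (extChartAt_target_mem_nhds (I := 𝓘(ℝ, F)) q)] with p hp
  exact inChart_twistorStructure S h hp.1 hp.2

variable [FiniteDimensional ℝ E] [FiniteDimensional ℂ F]

/-- Both the square and the Nijenhuis tensor can be computed at the centres of product charts. -/
theorem isComplexStructure_twistorStructure (hS : S.IsHyperKahler)
    (hh : ContMDiff 𝓘(ℂ, F) 𝓘(ℂ, ℂ) ω h) :
    IsComplexStructure (twistorStructure (F := F) S h) := by
  have : FiniteDimensional ℝ F := FiniteDimensional.complexToReal F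
  have : CompleteSpace (E × F) := FiniteDimensional.complete ℝ _
  have hI := fun m : M => (S.I.contMDiffAt_iff m).1 (S.isComplexStructure_I.smooth m)
  have hJ := fun m : M => (S.J.contMDiffAt_iff m).1 (S.isComplexStructure_J.smooth m)
  have hK := fun m : M => (S.K.contMDiffAt_iff m).1 (S.isComplexStructure_K.smooth m)
  have hs := fun (q : Q) k => contDiffAt_sphereInChart hh (mem_extChartAt_target q) k
  refine isComplexStructure_of_nijenhuis ?_ ?_ ?_
  · rintro ⟨m, q⟩
    refine ContDiffAt.congr_of_eventuallyEq ?_ (inChart_twistorStructure_eventuallyEq m q)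
    have key : ∀ (k : Fin 3) (A : E → E →L[ℝ] E), ContDiffAt ℝ ∞ A (extChartAt 𝓘(ℝ, E) m m) →
        ContDiffAt ℝ ∞ (fun p : E × F => sphereInChart h q k p.2 • A p.1)
          (extChartAt 𝓘(ℝ, E) m m, extChartAt 𝓘(ℝ, F) q q) := fun k A hA =>
      (ContDiffAt.comp (extChartAt 𝓘(ℝ, E) m m, extChartAt 𝓘(ℝ, F) q q) (f := Prod.snd)
        (hs q k) contDiffAt_snd).smul (ContDiffAt.comp _ (f := Prod.fst) hA contDiffAt_fst)
    exact (ContinuousLinearMap.prodMapL ℝ E E F F).contDiff.contDiffAt.comp _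
      ((((key 0 _ (hI m)).add (key 1 _ (hJ m))).add (key 2 _ (hK m))).prodMk contDiffAt_const)
  · rintro ⟨m, q⟩ v
    refine (twistorStructure_apply m q _).trans ?_
    have e := twistorStructure_apply (S := S) (h := h) m q v
    rw [show twistorStructure (F := F) S h (m, q) v = _ from e]
    simp only
    rw [HypercomplexStructure.endInChart_endInChart S (mem_extChartAt_target m), mulI_mulI]
    have h1 := sum_sq_toSphere (h q)
    simp only [sq] at h1
    rw [h1]
    refine Prod.ext ?_ rfl
    change _ = -v.1
    rw [HypercomplexStructure.endInChart_apply]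
    module
  · rintro ⟨m, q⟩ v w
    have hy := mem_extChartAt_target (I := 𝓘(ℝ, E)) m
    have hz := mem_extChartAt_target (I := 𝓘(ℝ, F)) q
    refine (nijenhuis_congr (inChart_twistorStructure_eventuallyEq m q) v w).trans ?_
    refine nijenhuis_prod_eq_zero (mulI F) ((hI m).differentiableAt (by simp))
      ((hJ m).differentiableAt (by simp)) ((hK m).differentiableAt (by simp))
      ((hs q 0).differentiableAt (by simp)) ((hs q 1).differentiableAt (by simp))
      ((hs q 2).differentiableAt (by simp)) (EndField.inChart_sq S.isComplexStructure_I.sq m hy)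
      (EndField.inChart_sq S.isComplexStructure_J.sq m hy)
      (EndField.inChart_sq S.isComplexStructure_K.sq m hy)
      (EndField.inChart_comp S.I_J m hy) (EndField.inChart_comp S.J_K m hy)
      (EndField.inChart_comp S.K_I m hy) (sum_sphereInChart_mul_fderiv hh hz)
      (fderiv_sphereInChart_mulI hh hz 0) (fderiv_sphereInChart_mulI hh hz 1)
      (fderiv_sphereInChart_mulI hh hz 2) ?_ v w
    exact hS.nijenhuis_endInChart (sum_sq_toSphere _)

theorem isSmooth_twistorForm (hS : S.IsHyperKahler) {ωQ : DForm 𝓘(ℝ, F) Q 2}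
    (hωQ : ωQ.IsSmooth) (hh : ContMDiff 𝓘(ℂ, F) 𝓘(ℂ, ℂ) ω h) (t : ℝ) :
    (twistorForm S h ωQ t).IsSmooth := by
  have : FiniteDimensional ℝ F := FiniteDimensional.complexToReal F
  rintro ⟨m, q⟩ p hp
  rw [extChartAt_prod] at hp
  obtain ⟨hy, hz⟩ := hp
  refine contDiffWithinAt_alternatingMap fun v => ContDiffAt.contDiffWithinAt ?_
  have hv : v = ![v 0, v 1] := by
    ext i <;> fin_cases i <;> rfl
  have hs := fun k => ContDiffAt.comp p (f := Prod.snd) (contDiffAt_sphereInChart hh hz k)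
    contDiffAt_snd
  have hω : ∀ {α : DForm 𝓘(ℝ, E) M 2}, α.IsSmooth → ContDiffAt ℝ ∞
      (fun p : E × F => α.inChart m p.1 ![(v 0).1, (v 1).1]) p := fun hα =>
    (ContinuousAlternatingMap.apply ℝ E ℝ ![(v 0).1, (v 1).1]).contDiff.contDiffAt.comp p
      (ContDiffAt.comp p (f := Prod.fst) (hα.contDiffAt hy) contDiffAt_fst)
  have hωQ' : ContDiffAt ℝ ∞ (fun p : E × F => ωQ.inChart q p.2 ![(v 0).2, (v 1).2]) p :=
    (ContinuousAlternatingMap.apply ℝ F ℝ ![(v 0).2, (v 1).2]).contDiff.contDiffAt.comp p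
      (ContDiffAt.comp p (f := Prod.snd) (hωQ.contDiffAt hz) contDiffAt_snd)
  refine ContDiffAt.congr_of_eventuallyEq (((((hs 0).mul (hω hS.isKahlerForm_I.smooth)).add
    ((hs 1).mul (hω hS.isKahlerForm_J.smooth))).add
    ((hs 2).mul (hω hS.isKahlerForm_K.smooth))).add ((contDiffAt_const (c := t)).mul hωQ')) ?_
  filter_upwards [prod_mem_nhds ((isOpen_extChartAt_target m).mem_nhds hy)
    ((isOpen_extChartAt_target q).mem_nhds hz)] with z hz
  rw [hv]
  exact inChart_twistorForm S h ωQ t hz.1 hz.2 _ _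

/-- The associated metric is `g + t ω_Q (·, √-1 ·)`. -/
theorem isPositiveForm_twistorForm (hS : S.IsHyperKahler) {ωQ : DForm 𝓘(ℝ, F) Q 2}
    (hωQ : IsPositiveForm (stdComplexStructure F Q) ωQ) (hh : ContMDiff 𝓘(ℂ, F) 𝓘(ℂ, ℂ) ω h)
    {t : ℝ} (ht : 0 < t) :
    IsPositiveForm (twistorStructure (F := F) S h) (twistorForm S h ωQ t) where
  smooth := isSmooth_twistorForm hS hωQ.smooth hh t
  invariant := by
    rintro ⟨m, q⟩ v w
    have hy := mem_extChartAt_target (I := 𝓘(ℝ, E)) m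
    refine (twistorForm_apply_eq_metricInChart ωQ t m q _ _).trans
      (Eq.trans ?_ (twistorForm_apply_eq_metricInChart ωQ t m q v w).symm)
    have e := fun v : E × F => twistorStructure_apply (S := S) (h := h) m q v
    rw [show twistorStructure (F := F) S h (m, q) v = _ from e v,
      show twistorStructure (F := F) S h (m, q) w = _ from e w]
    simp only
    rw [HypercomplexStructure.metricInChart_endInChart_endInChart S hy (sum_sq_toSphere _)]
    exact congrArg (fun x => _ + t * x) (hωQ.invariant q v.2 w.2)
  pos := by
    rintro ⟨m, q⟩ v hv
    have hy := mem_extChartAt_target (I := 𝓘(ℝ, E)) m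
    have e := twistorStructure_apply (S := S) (h := h) m q v
    rw [show twistorStructure (F := F) S h (m, q) v = _ from e]
    refine lt_of_lt_of_eq ?_ (twistorForm_apply_eq_metricInChart ωQ t m q v _).symm
    simp only
    rw [HypercomplexStructure.metricInChart_endInChart_endInChart S hy (sum_sq_toSphere _)]
    have h1 : 0 ≤ S.metricInChart m (extChartAt 𝓘(ℝ, E) m m) v.1 v.1 := by
      by_cases h0 : v.1 = 0
      · rw [h0]
        have := S.metricInChart_smul_left (m := m) (y := extChartAt 𝓘(ℝ, E) m m) 0 0 0
        rw [zero_smul, zero_mul] at this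
        exact this.ge
      · exact (S.metricInChart_pos hy h0).le
    have h2 : 0 ≤ ωQ q ![v.2, mulI F v.2] := by
      by_cases h0 : v.2 = 0
      · rw [h0]
        exact ((ωQ q).map_coord_zero (0 : Fin 2) rfl).ge
      · exact (hωQ.pos q v.2 h0).le
    by_cases h0 : v.1 = 0
    · have h3 : v.2 ≠ 0 := fun h3 => hv (Prod.ext h0 h3)
      exact add_pos_of_nonneg_of_pos h1 (mul_pos ht (hωQ.pos q v.2 h3))
    · exact add_pos_of_pos_of_nonneg (S.metricInChart_pos hy h0) (mul_nonneg ht.le h2)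

end TwistorStructure

/-! ### Unitary bases -/

section Unitary

variable {V : Type*} [NormedAddCommGroup V] [NormedSpace ℝ V]

/-- Gram–Schmidt for positive `(1,1)`-forms: there are as many orthogonal complex lines as the
dimension permits. -/
theorem exists_unitary_family [FiniteDimensional ℝ V] (α : V [⋀^Fin 2]→L[ℝ] ℝ) (J : V →L[ℝ] V)
    (k : ℕ) (hk : 2 * k ≤ finrank ℝ V) :
    ∃ e : Fin k → V, (∀ i, e i ≠ 0) ∧
      ∀ i j, i < j → α ![e j, e i] = 0 ∧ α ![e j, J (e i)] = 0 := by
  induction k with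
  | zero => exact ⟨Fin.elim0, fun i => i.elim0, fun i => i.elim0⟩
  | succ k ih =>
    obtain ⟨e, he, horth⟩ := ih (by omega)
    let L : V →ₗ[ℝ] (Fin k × Fin 2 → ℝ) :=
      { toFun := fun x p => α ![x, ![e p.1, J (e p.1)] p.2]
        map_add' := fun x y => by
          ext p
          simp only [← twoFormL_apply, map_add, Pi.add_apply]
          rfl
        map_smul' := fun c x => by
          ext p
          simp only [← twoFormL_apply, map_smul, Pi.smul_apply, RingHom.id_apply]
          rfl }
    have hL : LinearMap.ker L ≠ ⊥ := by
      refine LinearMap.ker_ne_bot_of_finrank_lt ?_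
      simp only [finrank_fintype_fun_eq_card, Fintype.card_prod, Fintype.card_fin]
      omega
    obtain ⟨x, hx, hx0⟩ := (Submodule.ne_bot_iff _).1 hL
    have hx1 : ∀ i, α ![x, e i] = 0 := fun i => congrFun hx (i, 0)
    have hx2 : ∀ i, α ![x, J (e i)] = 0 := fun i => congrFun hx (i, 1)
    refine ⟨Fin.snoc e x, fun i => ?_, fun i j hij => ?_⟩
    · induction i using Fin.lastCases with
      | last => simpa using hx0
      | cast i => simpa using he i
    · induction i using Fin.lastCases with
      | last => exact absurd hij (not_lt.2 (Fin.le_last j))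
      | cast i =>
        induction j using Fin.lastCases with
        | last => simpa using ⟨hx1 i, hx2 i⟩
        | cast j => simpa using horth i j (by simpa using hij)

/-- A positive `(1,1)`-form on a vector space has a unitary basis, here with respect to the real
numbers: it consists of pairs `e_j`, `J e_j` spanning pairwise orthogonal planes. -/
theorem exists_unitary_basis [FiniteDimensional ℝ V] (α : V [⋀^Fin 2]→L[ℝ] ℝ) (J : V →L[ℝ] V)
    (hJ : ∀ v, J (J v) = -v) (hα : ∀ v w, α ![J v, J w] = α ![v, w])
    (hpos : ∀ v, v ≠ 0 → 0 < α ![v, J v]) {r : ℕ} (hr : finrank ℝ V = 2 * r) :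
    ∃ b : Basis (Fin r × Bool) ℝ V, (∀ j, b (j, true) = J (b (j, false))) ∧
      ∀ i j s t, i ≠ j → α ![b (i, s), b (j, t)] = 0 := by
  obtain ⟨e, he, horth⟩ := exists_unitary_family α J r hr.ge
  let b : Fin r × Bool → V := fun p => cond p.2 (J (e p.1)) (e p.1)
  have hneg : ∀ v w, α ![J v, w] = -α ![v, J w] := by
    intro v w
    rw [← hα v, hJ, ← twoFormL_apply, ← twoFormL_apply, map_neg, neg_neg]
  have hnegr : ∀ v w, α ![v, -w] = -α ![v, w] := fun v w => by
    rw [← twoFormL_apply, map_neg, twoFormL_apply]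
  have h1 : ∀ i j, i ≠ j → α ![e i, e j] = 0 ∧ α ![e i, J (e j)] = 0 := by
    intro i j hij
    rcases lt_or_gt_of_ne hij with h | h
    · rw [twoForm_swap, (horth i j h).1, twoForm_swap, hneg, (horth i j h).2]
      simp
    · exact horth j i h
  have hb : ∀ i j s t, i ≠ j → α ![b (i, s), b (j, t)] = 0 := by
    intro i j s t hij
    obtain ⟨h2, h3⟩ := h1 i j hij
    cases s <;> cases t <;> simp only [b, cond, hα, hneg, h2, h3, neg_zero]
  have hbJ : ∀ p p', p ≠ p' → α ![b p, J (b p')] = 0 := by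
    rintro ⟨i, s⟩ ⟨j, t⟩ hp
    by_cases hij : i = j
    · subst hij
      cases s <;> cases t <;> simp_all [b, twoForm_self]
    · obtain ⟨h2, h3⟩ := h1 i j hij
      cases s <;> cases t <;> simp [b, hα, h2, h3, hJ, hneg, hnegr]
  have hbpos : ∀ p, 0 < α ![b p, J (b p)] := by
    rintro ⟨i, s⟩
    cases s
    · exact hpos _ (he i)
    · change 0 < α ![J (e i), J (J (e i))]
      rw [hα]
      exact hpos _ (he i)
  have hli : LinearIndependent ℝ b := by
    rw [Fintype.linearIndependent_iff]
    intro c hc p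
    have h2 : ∑ p', c p' * α ![b p', J (b p)] = 0 := by
      have := congrArg (fun v => twoFormL α v (J (b p))) hc
      simpa [map_sum, _root_.sum_apply, twoFormL_apply] using this
    rw [Finset.sum_eq_single p (fun p' _ hp => by rw [hbJ _ _ hp, mul_zero]) (by simp)] at h2
    exact (mul_eq_zero.1 h2).resolve_right (hbpos p).ne'
  have hcard : Fintype.card (Fin r × Bool) = finrank ℝ V := by
    rw [hr, Fintype.card_prod, Fintype.card_fin, Fintype.card_bool, mul_comm]
  refine ⟨basisOfLinearIndependentOfCardEqFinrank' b hli hcard, fun j => ?_, ?_⟩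
  · simp [b]
  · simpa using hb

end Unitary

/-! ### The exterior derivative of the twistor form -/

section TwistorDerivative

theorem twoFormPow_compContinuousLinearMap {V W : Type*} [NormedAddCommGroup V] [NormedSpace ℝ V]
    [NormedAddCommGroup W] [NormedSpace ℝ W] (α : V [⋀^Fin 2]→L[ℝ] ℝ) (D : W →L[ℝ] V) (k : ℕ) :
    (twoFormPow α k).compContinuousLinearMap D = twoFormPow (α.compContinuousLinearMap D) k := by
  ext v
  rw [ContinuousAlternatingMap.compContinuousLinearMap_apply, twoFormPow_apply, twoFormPow_apply]
  refine congrArg (_ * ·) (Finset.sum_congr rfl fun σ _ => congrArg (_ • ·)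
    (Finset.prod_congr rfl fun i _ => congrArg α ?_))
  ext l
  fin_cases l <;> rfl

theorem fderiv_alternatingMap_apply {V X : Type*} [NormedAddCommGroup V] [NormedSpace ℝ V]
    [NormedAddCommGroup X] [NormedSpace ℝ X] {k : ℕ} {f : X → V [⋀^Fin k]→L[ℝ] ℝ} {x : X}
    (hf : DifferentiableAt ℝ f x) (u : X) (v : Fin k → V) :
    fderiv ℝ (fun y => f y v) x u = fderiv ℝ f x u v := by
  have := (ContinuousAlternatingMap.apply ℝ V ℝ v).hasFDerivAt.comp x hf.hasFDerivAt
  exact congrArg (fun L : X →L[ℝ] ℝ => L u) this.fderiv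

variable {E : Type*} [NormedAddCommGroup E] [NormedSpace ℝ E] [FiniteDimensional ℝ E]
  {M : Type*} [TopologicalSpace M] [ChartedSpace E M] [IsManifold 𝓘(ℝ, E) ∞ M]
  {F : Type*} [NormedAddCommGroup F] [NormedSpace ℂ F] [FiniteDimensional ℂ F]
  {Q : Type*} [TopologicalSpace Q] [ChartedSpace F Q] [IsManifold 𝓘(ℂ, F) ω Q]
  {S : HypercomplexStructure (E := E) M} {h : Q → CP1}

/-- The form `da(u) ω_I + db(u) ω_J + dc(u) ω_K` on the tangent space of `M` at `m`, for a tangent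
vector `u` of `Q` at `q`. -/
def twistorVariation (S : HypercomplexStructure (E := E) M) (h : Q → CP1) (m : M) (q : Q) (u : F) :
    E [⋀^Fin 2]→L[ℝ] ℝ :=
  S.formInChart m (fderiv ℝ (sphereInChart h q 0) (extChartAt 𝓘(ℝ, F) q q) u)
    (fderiv ℝ (sphereInChart h q 1) (extChartAt 𝓘(ℝ, F) q q) u)
    (fderiv ℝ (sphereInChart h q 2) (extChartAt 𝓘(ℝ, F) q q) u) (extChartAt 𝓘(ℝ, E) m m)

/-- The product rule for `a ω_I + b ω_J + c ω_K + t ω_Q`. -/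
theorem fderiv_inChart_twistorForm (hS : S.IsHyperKahler) {ωQ : DForm 𝓘(ℝ, F) Q 2}
    (hωQ : ωQ.IsSmooth) (hh : ContMDiff 𝓘(ℂ, F) 𝓘(ℂ, ℂ) ω h) (t : ℝ) (m : M) (q : Q)
    (u v w : E × F) :
    fderiv ℝ ((twistorForm S h ωQ t).inChart (m, q))
      (extChartAt (𝓘(ℝ, E).prod 𝓘(ℝ, F)) (m, q) (m, q)) u ![v, w] =
      twistorVariation S h m q u.2 ![v.1, w.1]
        + fderiv ℝ (S.formInChart m ((h q).toSphere 0) ((h q).toSphere 1) ((h q).toSphere 2))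
          (extChartAt 𝓘(ℝ, E) m m) u.1 ![v.1, w.1]
        + t * fderiv ℝ (ωQ.inChart q) (extChartAt 𝓘(ℝ, F) q q) u.2 ![v.2, w.2] := by
  have hy := mem_extChartAt_target (I := 𝓘(ℝ, E)) m
  have hz := mem_extChartAt_target (I := 𝓘(ℝ, F)) q
  have hs := fun k => (contDiffAt_sphereInChart hh hz k).differentiableAt (by simp)
  have hI := (hS.isKahlerForm_I.smooth.contDiffAt hy).differentiableAt (by simp)
  have hJ := (hS.isKahlerForm_J.smooth.contDiffAt hy).differentiableAt (by simp)
  have hK := (hS.isKahlerForm_K.smooth.contDiffAt hy).differentiableAt (by simp)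
  have hQ := (hωQ.contDiffAt hz).differentiableAt (by simp)
  have hev : ∀ {α : DForm 𝓘(ℝ, E) M 2},
      DifferentiableAt ℝ (α.inChart m) (extChartAt 𝓘(ℝ, E) m m) →
      DifferentiableAt ℝ (fun y => α.inChart m y ![v.1, w.1]) (extChartAt 𝓘(ℝ, E) m m) := fun hα =>
    (ContinuousAlternatingMap.apply ℝ E ℝ ![v.1, w.1]).differentiableAt.comp _ hα
  have hevQ : DifferentiableAt ℝ (fun z => ωQ.inChart q z ![v.2, w.2])
      (extChartAt 𝓘(ℝ, F) q q) :=
    (ContinuousAlternatingMap.apply ℝ F ℝ ![v.2, w.2]).differentiableAt.comp _ hQ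
  have hD := (((hasFDerivAt_smul_prod (hs 0) (hev hI)).add
    (hasFDerivAt_smul_prod (hs 1) (hev hJ))).add (hasFDerivAt_smul_prod (hs 2) (hev hK))).add
    ((HasFDerivAt.comp (extChartAt 𝓘(ℝ, E) m m, extChartAt 𝓘(ℝ, F) q q) (f := Prod.snd)
      hevQ.hasFDerivAt hasFDerivAt_snd).const_mul t)
  have hev2 : (fun p : E × F => (twistorForm S h ωQ t).inChart (m, q) p ![v, w])
      =ᶠ[𝓝 (extChartAt 𝓘(ℝ, E) m m, extChartAt 𝓘(ℝ, F) q q)] fun p =>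
        sphereInChart h q 0 p.2 * S.omegaI.inChart m p.1 ![v.1, w.1]
        + sphereInChart h q 1 p.2 * S.omegaJ.inChart m p.1 ![v.1, w.1]
        + sphereInChart h q 2 p.2 * S.omegaK.inChart m p.1 ![v.1, w.1]
        + t * ωQ.inChart q p.2 ![v.2, w.2] := by
    filter_upwards [prod_mem_nhds (extChartAt_target_mem_nhds (I := 𝓘(ℝ, E)) m)
      (extChartAt_target_mem_nhds (I := 𝓘(ℝ, F)) q)] with p hp
    exact inChart_twistorForm S h ωQ t hp.1 hp.2 _ _
  have hform : DifferentiableAt ℝ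
      (S.formInChart m ((h q).toSphere 0) ((h q).toSphere 1) ((h q).toSphere 2))
      (extChartAt 𝓘(ℝ, E) m m) :=
    (hS.contDiffAt_formInChart hy _ _ _).differentiableAt (by simp)
  have hform' : fderiv ℝ (fun y => S.formInChart m ((h q).toSphere 0) ((h q).toSphere 1)
      ((h q).toSphere 2) y ![v.1, w.1]) (extChartAt 𝓘(ℝ, E) m m) =
      (h q).toSphere 0 • fderiv ℝ (fun y => S.omegaI.inChart m y ![v.1, w.1]) (extChartAt 𝓘(ℝ, E) m m)
        + (h q).toSphere 1 • fderiv ℝ (fun y => S.omegaJ.inChart m y ![v.1, w.1]) (extChartAt 𝓘(ℝ, E) m m)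
        + (h q).toSphere 2 • fderiv ℝ (fun y => S.omegaK.inChart m y ![v.1, w.1]) (extChartAt 𝓘(ℝ, E) m m) :=
    ((((hev hI).hasFDerivAt.const_smul ((h q).toSphere 0)).add
      ((hev hJ).hasFDerivAt.const_smul ((h q).toSphere 1))).add
      ((hev hK).hasFDerivAt.const_smul ((h q).toSphere 2))).fderiv
  have hsq : ∀ k, sphereInChart h q k (extChartAt 𝓘(ℝ, F) q q) = (h q).toSphere k := by
    intro k
    rw [sphereInChart, extChartAt_to_inv]
  have hsm := ((isSmooth_twistorForm hS hωQ hh t).contDiffAt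
    (mem_extChartAt_target (I := 𝓘(ℝ, E).prod 𝓘(ℝ, F)) (m, q))).differentiableAt (by simp)
  rw [← fderiv_alternatingMap_apply hsm]
  refine (congrArg (fun L : E × F →L[ℝ] ℝ => L u)
    ((hD.congr_of_eventuallyEq hev2).fderiv)).trans ?_
  rw [← fderiv_alternatingMap_apply hform, hform', ← hsq, ← hsq, ← hsq,
    ← fderiv_alternatingMap_apply hQ]
  have hvar : twistorVariation S h m q u.2 ![v.1, w.1] =
      fderiv ℝ (sphereInChart h q 0) (extChartAt 𝓘(ℝ, F) q q) u.2 *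
          S.omegaI.inChart m (extChartAt 𝓘(ℝ, E) m m) ![v.1, w.1]
        + fderiv ℝ (sphereInChart h q 1) (extChartAt 𝓘(ℝ, F) q q) u.2 *
          S.omegaJ.inChart m (extChartAt 𝓘(ℝ, E) m m) ![v.1, w.1]
        + fderiv ℝ (sphereInChart h q 2) (extChartAt 𝓘(ℝ, F) q q) u.2 *
          S.omegaK.inChart m (extChartAt 𝓘(ℝ, E) m m) ![v.1, w.1] := rfl
  rw [hvar]
  simp
  ring

/-- At the centre of a chart, the exterior derivative of `ω_M + t ω_Q` is
`da ∧ ω_I + db ∧ ω_J + dc ∧ ω_K`. -/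
theorem extDeriv_inChart_twistorForm (hS : S.IsHyperKahler) {ωQ : DForm 𝓘(ℝ, F) Q 2}
    (hωQ : IsKahlerForm (stdComplexStructure F Q) ωQ)
    (hh : ContMDiff 𝓘(ℂ, F) 𝓘(ℂ, ℂ) ω h) (t : ℝ) (m : M) (q : Q) (u v w : E × F) :
    extDeriv ((twistorForm S h ωQ t).inChart (m, q))
      (extChartAt (𝓘(ℝ, E).prod 𝓘(ℝ, F)) (m, q) (m, q)) ![u, v, w] =
      twistorVariation S h m q u.2 ![v.1, w.1] - twistorVariation S h m q v.2 ![u.1, w.1]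
        + twistorVariation S h m q w.2 ![u.1, v.1] := by
  rw [extDeriv_two_apply]
  simp only [fderiv_inChart_twistorForm hS hωQ.smooth hh]
  have h1 := hS.extDeriv_formInChart (m := m) ((h q).toSphere 0) ((h q).toSphere 1)
    ((h q).toSphere 2)
  have h2 := (DForm.d_eq_zero_iff _).1 hωQ.closed q
  have h3 : extDeriv (S.formInChart m ((h q).toSphere 0) ((h q).toSphere 1) ((h q).toSphere 2))
      (extChartAt 𝓘(ℝ, E) m m) ![u.1, v.1, w.1] = 0 := by
    rw [h1]
    rfl
  have h4 : extDeriv (ωQ.inChart q) (extChartAt 𝓘(ℝ, F) q q) ![u.2, v.2, w.2] = 0 := by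
    rw [h2]
    rfl
  rw [extDeriv_two_apply] at h3 h4
  linear_combination h3 + t * h4

end TwistorDerivative

/-! ### The twistor form is balanced -/

section Balanced

theorem DForm.inChart_pow {E : Type*} [NormedAddCommGroup E] [NormedSpace ℝ E]
    {H : Type*} [TopologicalSpace H] {I : ModelWithCorners ℝ E H}
    {N : Type*} [TopologicalSpace N] [ChartedSpace H N] (α : DForm I N 2) (k : ℕ) (x₀ : N) :
    (α.pow k).inChart x₀ = fun y => twoFormPow (α.inChart x₀ y) k := by
  funext y
  exact twoFormPow_compContinuousLinearMap (V := E)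
    (show E [⋀^Fin 2]→L[ℝ] ℝ from α ((extChartAt I x₀).symm y)) (chartSymmDeriv I x₀ y) k

variable {E : Type*} [NormedAddCommGroup E] [NormedSpace ℝ E]
  {M : Type*} [TopologicalSpace M] [ChartedSpace E M] [IsManifold 𝓘(ℝ, E) ∞ M]
  {F : Type*} [NormedAddCommGroup F] [NormedSpace ℂ F]
  {Q : Type*} [TopologicalSpace Q] [ChartedSpace F Q]
  {S : HypercomplexStructure (E := E) M} {h : Q → CP1}

theorem twistorVariation_zero (m : M) (q : Q) : twistorVariation S h m q (0 : F) = 0 := by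
  simp [twistorVariation, HypercomplexStructure.formInChart]

variable [IsManifold 𝓘(ℂ, F) ω Q]

/-- The variation of `ω_M` vanishes on the complex lines of `I_M`, because
`a da + b db + c dc = 0`. -/
theorem twistorVariation_endInChart (hh : ContMDiff 𝓘(ℂ, F) 𝓘(ℂ, ℂ) ω h) (m : M) (q : Q) (u : F)
    (e : E) : twistorVariation S h m q u
      ![e, S.endInChart m ((h q).toSphere 0) ((h q).toSphere 1) ((h q).toSphere 2)
        (extChartAt 𝓘(ℝ, E) m m) e] = 0 := by
  have hy := mem_extChartAt_target (I := 𝓘(ℝ, E)) m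
  have h1 := sum_sphereInChart_mul_fderiv hh (mem_extChartAt_target (I := 𝓘(ℝ, F)) q) u
  have hsq : ∀ k, sphereInChart h q k (extChartAt 𝓘(ℝ, F) q q) = (h q).toSphere k := by
    intro k
    rw [sphereInChart, extChartAt_to_inv]
  simp only [hsq] at h1
  have h2 : ∀ a b c : ℝ, S.metricInChart m (extChartAt 𝓘(ℝ, E) m m)
      (S.endInChart m a b c (extChartAt 𝓘(ℝ, E) m m) e) e = 0 := fun a b c => by
    rw [← HypercomplexStructure.formInChart_apply S hy, twoForm_self]
  rw [twoForm_swap, twistorVariation, HypercomplexStructure.formInChart_apply S hy,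
    HypercomplexStructure.endInChart_endInChart S hy,
    HypercomplexStructure.metricInChart_add_left, HypercomplexStructure.metricInChart_smul_left,
    h2]
  linear_combination S.metricInChart m (extChartAt 𝓘(ℝ, E) m m) e e * h1

variable [FiniteDimensional ℝ E] [FiniteDimensional ℂ F]

theorem isBalancedMetric_twistorForm (hS : S.IsHyperKahler) {ωQ : DForm 𝓘(ℝ, F) Q 2}
    (hωQ : IsKahlerForm (stdComplexStructure F Q) ωQ)
    (hh : ContMDiff 𝓘(ℂ, F) 𝓘(ℂ, ℂ) ω h) {t : ℝ} (ht : 0 < t) {r n : ℕ}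
    (hr : finrank ℝ E = 2 * r) (hn : finrank ℂ F = n) :
    IsBalancedMetric (twistorStructure (F := F) S h) (n + r) (twistorForm S h ωQ t) where
  toIsPositiveForm := isPositiveForm_twistorForm hS hωQ.toIsPositiveForm hh ht
  finrank_eq := by
    have : FiniteDimensional ℝ F := FiniteDimensional.complexToReal F
    rw [finrank_prod, hr, finrank_real_of_complex, hn]
    ring
  closed_pow := by
    have : FiniteDimensional ℝ F := FiniteDimensional.complexToReal F
    have hnF : finrank ℝ F = 2 * n := by rw [finrank_real_of_complex, hn]
    rw [DForm.d_eq_zero_iff]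
    rintro ⟨m, q⟩
    rw [DForm.inChart_pow]
    have hy := mem_extChartAt_target (I := 𝓘(ℝ, E)) m
    have h1 := sum_sq_toSphere (h q)
    -- a unitary basis of `T_m M ⊕ T_q Q` that is adapted to the splitting
    obtain ⟨b₁, hb₁J, hb₁⟩ := exists_unitary_basis (r := r)
      (S.formInChart m ((h q).toSphere 0) ((h q).toSphere 1) ((h q).toSphere 2)
        (extChartAt 𝓘(ℝ, E) m m))
      (S.endInChart m ((h q).toSphere 0) ((h q).toSphere 1) ((h q).toSphere 2)
        (extChartAt 𝓘(ℝ, E) m m))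
      (fun v => by
        rw [HypercomplexStructure.endInChart_endInChart S hy,
          HypercomplexStructure.endInChart_apply,
          show (h q).toSphere 0 * (h q).toSphere 0 + (h q).toSphere 1 * (h q).toSphere 1
            + (h q).toSphere 2 * (h q).toSphere 2 = 1 by linarith]
        module)
      (fun v w => by
        rw [HypercomplexStructure.formInChart_apply S hy,
          HypercomplexStructure.formInChart_apply S hy,
          HypercomplexStructure.metricInChart_endInChart_endInChart S hy h1])
      (fun v hv => by
        rw [HypercomplexStructure.formInChart_apply S hy,
          HypercomplexStructure.metricInChart_endInChart_endInChart S hy h1]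
        exact S.metricInChart_pos hy hv) hr
    obtain ⟨b₂, hb₂J, hb₂⟩ := exists_unitary_basis (r := n)
      (show F [⋀^Fin 2]→L[ℝ] ℝ from ωQ q) (mulI F) mulI_mulI (hωQ.invariant q) (hωQ.pos q) hnF
    let b : Basis ((Fin r ⊕ Fin n) × Bool) ℝ (E × F) :=
      (b₁.prod b₂).reindex (Equiv.sumProdDistrib (Fin r) (Fin n) Bool).symm
    have hbl : ∀ i s, b (Sum.inl i, s) = (b₁ (i, s), 0) := fun i s => by
      simp [b]
    have hbr : ∀ i s, b (Sum.inr i, s) = (0, b₂ (i, s)) := fun i s => by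
      simp [b]
    refine extDeriv_twoFormPow_eq_zero
      (((isSmooth_twistorForm hS hωQ.smooth hh t).contDiffAt
        (mem_extChartAt_target (m, q))).of_le (by simp)) b ?_ ?_ _ ?_
    · rintro (j | j) u
      · rw [extDeriv_inChart_twistorForm hS hωQ hh, hbl, hbl, hb₁J, twistorVariation_zero,
          twistorVariation_endInChart hh]
        simp
      · rw [extDeriv_inChart_twistorForm hS hωQ hh, hbr, hbr]
        simp only [twoForm_zero_left, sub_zero, add_zero]
    · intro i j s s' hij
      rw [DForm.inChart_self]
      refine (twistorForm_apply_eq_metricInChart ωQ t m q _ _).trans ?_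
      rw [← HypercomplexStructure.formInChart_apply S hy]
      have hzero : ∀ {x y : ℝ}, x = 0 → y = 0 → x + t * y = 0 := fun hx hy => by
        rw [hx, hy, mul_zero, add_zero]
      rcases i with i | i <;> rcases j with j | j <;> simp only [hbl, hbr]
      · exact hzero (hb₁ _ _ _ _ fun hc => hij (by rw [hc])) (twoForm_zero_left (V := F) _ _)
      · exact hzero (twoForm_zero_right _ _) (twoForm_zero_left (V := F) _ _)
      · exact hzero (twoForm_zero_left _ _) (twoForm_zero_right (V := F) _ _)
      · exact hzero (twoForm_zero_left _ _) (hb₂ _ _ _ _ fun hc => hij (by rw [hc]))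
    · simp
      omega

end Balanced

/-! ### The twistor form is not Kähler -/

section NotKahler

variable {E : Type*} [NormedAddCommGroup E] [NormedSpace ℝ E]
  {M : Type*} [TopologicalSpace M] [ChartedSpace E M] [IsManifold 𝓘(ℝ, E) ∞ M]
  {F : Type*} [NormedAddCommGroup F] [NormedSpace ℂ F]
  {Q : Type*} [TopologicalSpace Q] [ChartedSpace F Q] [IsManifold 𝓘(ℂ, F) ω Q]
  {S : HypercomplexStructure (E := E) M} {h : Q → CP1}

theorem isLocallyConstant_of_fderiv_sphereInChart_eq_zero (hh : ContMDiff 𝓘(ℂ, F) 𝓘(ℂ, ℂ) ω h)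
    (hd : ∀ q k, fderiv ℝ (sphereInChart h q k) (extChartAt 𝓘(ℝ, F) q q) = 0) :
    IsLocallyConstant h := by
  -- transition maps carry the vanishing at the centres of the charts to all points of the charts
  have hd' : ∀ q k, ∀ z ∈ (extChartAt 𝓘(ℝ, F) q).target,
      fderiv ℝ (sphereInChart h q k) z = 0 := by
    intro q k z hz
    set q' := (extChartAt 𝓘(ℝ, F) q).symm z with hq'
    have hτ := (differentiableAt_chartTransition hz
      (mem_extChartAt_source (I := 𝓘(ℝ, F)) q')).hasFDerivAt
    have hs : HasFDerivAt (sphereInChart h q' k) (0 : F →L[ℝ] ℝ)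
        ((extChartAt 𝓘(ℝ, F) q' ∘ (extChartAt 𝓘(ℝ, F) q).symm) z) := by
      have := ((contDiffAt_sphereInChart hh (mem_extChartAt_target (I := 𝓘(ℝ, F)) q')
        k).differentiableAt (by simp)).hasFDerivAt
      rwa [hd q' k] at this
    have hc := hs.comp z hτ
    rw [ContinuousLinearMap.zero_comp] at hc
    refine (hc.congr_of_eventuallyEq ?_).fderiv
    have hcont : ContinuousAt (extChartAt 𝓘(ℝ, F) q).symm z := continuousAt_extChartAt_symm'' hz
    filter_upwards [hcont.preimage_mem_nhds (extChartAt_source_mem_nhds (I := 𝓘(ℝ, F)) q')]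
      with y hy
    simp only [Function.comp_apply, sphereInChart]
    rw [(extChartAt 𝓘(ℝ, F) q').left_inv hy]
  rw [IsLocallyConstant.iff_eventually_eq]
  intro q
  obtain ⟨ε, hε, hball⟩ := Metric.mem_nhds_iff.1 (extChartAt_target_mem_nhds (I := 𝓘(ℝ, F)) q)
  filter_upwards [(continuousAt_extChartAt (I := 𝓘(ℝ, F)) q).preimage_mem_nhds
    (Metric.ball_mem_nhds _ hε), extChartAt_source_mem_nhds (I := 𝓘(ℝ, F)) q] with p hp hps
  refine toSphere_injective (funext fun k => ?_)
  have := Metric.isOpen_ball.is_const_of_fderiv_eq_zero (𝕜 := ℝ) (f := sphereInChart h q k)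
    (convex_ball (extChartAt 𝓘(ℝ, F) q q) ε).isPreconnected
    (fun z hz => ((contDiffAt_sphereInChart hh (hball hz) k).differentiableAt
      (by simp)).differentiableWithinAt)
    (fun z hz => hd' q k z (hball hz)) hp (Metric.mem_ball_self hε)
  rwa [sphereInChart, sphereInChart, (extChartAt 𝓘(ℝ, F) q).left_inv hps, extChartAt_to_inv]
    at this

variable [FiniteDimensional ℝ E] [FiniteDimensional ℂ F]

/-- If the exterior derivative vanishes at all points, so does the derivative of `h`: insert one
vector tangent to `Q` and two vectors tangent to `M`. -/
theorem not_isKahlerForm_twistorForm (hS : S.IsHyperKahler) {ωQ : DForm 𝓘(ℝ, F) Q 2}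
    (hωQ : IsKahlerForm (stdComplexStructure F Q) ωQ)
    (hh : ContMDiff 𝓘(ℂ, F) 𝓘(ℂ, ℂ) ω h) (t : ℝ) [Nonempty M] [Nontrivial E]
    (hc : ¬ IsLocallyConstant h) :
    ¬ IsKahlerForm (twistorStructure (F := F) S h) (twistorForm S h ωQ t) := by
  intro hK
  refine hc (isLocallyConstant_of_fderiv_sphereInChart_eq_zero hh fun q k => ?_)
  obtain ⟨m⟩ := ‹Nonempty M›
  obtain ⟨v, hv⟩ := exists_ne (0 : E)
  ext u
  have hd := (DForm.d_eq_zero_iff _).1 hK.closed (m, q)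
  have h1 : ∀ w, twistorVariation S h m q u ![v, w] = 0 := by
    intro w
    have h2 := extDeriv_inChart_twistorForm hS hωQ hh t m q (0, u) (v, 0) (w, 0)
    rw [hd] at h2
    simp only [twistorVariation_zero] at h2
    simpa using h2.symm
  have h3 := HypercomplexStructure.formInChart_nondegenerate (mem_extChartAt_target m) h1 hv
  have h4 : ∀ x y z : ℝ, x * x + y * y + z * z = 0 → x = 0 ∧ y = 0 ∧ z = 0 := by
    intro x y z hxyz
    refine ⟨?_, ?_, ?_⟩ <;> nlinarith [mul_self_nonneg x, mul_self_nonneg y, mul_self_nonneg z]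
  obtain ⟨e0, e1, e2⟩ := h4 _ _ _ h3
  fin_cases k
  · exact e0
  · exact e1
  · exact e2

end NotKahler

end

theorem mainTheorem2
    {E : Type*} [NormedAddCommGroup E] [NormedSpace ℝ E] [FiniteDimensional ℝ E]
    {M : Type*} [TopologicalSpace M] [ChartedSpace E M] [IsManifold 𝓘(ℝ, E) ∞ M]
    {F : Type*} [NormedAddCommGroup F] [NormedSpace ℂ F] [FiniteDimensional ℂ F]
    {Q : Type*} [TopologicalSpace Q] [ChartedSpace F Q] [IsManifold 𝓘(ℂ, F) ω Q]
    (r n : ℕ) (hr : finrank ℝ E = 2 * r) (hn : finrank ℂ F = n)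
    (S : HypercomplexStructure (E := E) M) (hS : S.IsHyperKahler)
    (ωQ : DForm 𝓘(ℝ, F) Q 2) (hωQ : IsKahlerForm (stdComplexStructure F Q) ωQ)
    (h : Q → CP1) (hh : ContMDiff 𝓘(ℂ, F) 𝓘(ℂ, ℂ) ω h)
    (t : ℝ) (ht : 0 < t) :
    IsComplexStructure (twistorStructure (F := F) S h) ∧
    IsBalancedMetric (twistorStructure (F := F) S h) (n + r) (twistorForm S h ωQ t) ∧
    (Nonempty M → 0 < r → ¬ IsLocallyConstant h →
      ¬ IsKahlerForm (twistorStructure (F := F) S h) (twistorForm S h ωQ t)) := by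
  refine ⟨isComplexStructure_twistorStructure hS hh,
    isBalancedMetric_twistorForm hS hωQ hh ht hr hn, fun hM hr0 hc => ?_⟩
  have : Nontrivial E := nontrivial_of_finrank_pos (R := ℝ) (by omega)
  exact not_isKahlerForm_twistorForm hS hωQ hh t hc
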